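/- Consider the Abel equation of the second kind $$(486R^4-171R^2+5+9Rz)\,z'_R=972R^4-162R^2+(1458R^3-225R)z+27z^2 \qquad (1)$$ and the equivalent equation for $R(z)$, $$R'_z=\frac{486R^4-171R^2+9zR+5}{9(54R^3-9R+z)(2R+3z)}. \qquad (2)$$ Write $P(R,z)$ for the coefficient of $z'_R$ and $Q(R,z)=9(54R^3-9R+z)(2R+3z)$ for the right-hand side of (1). Let $F(\alpha,\beta;\gamma;y)$ be the Gauss hypergeometric function and put $$I=\frac{997920\, i\sqrt{15}\,\bigl(F(-\frac76,-\frac16;\frac23;c_1)(a_1b_6+b_8)+\frac{12789}{220}F(-\frac16,\frac56;\frac53;c_1)\,a_1c_2\bigr)}{c_1^{1/3}\bigl(F(-\frac56,\frac16;\frac43;c_1)\,b_7+77711400\,F(\frac16,\frac76;\frac73;c_1)\,a_1(b_5+b_9)\bigr)},$$ where $a_1=R^2-\frac13$, $a_2=R^4-\frac{25}{111}R^2+\frac1{1332}$, $a_3=R^3-\frac{2R}7+\frac z{14}$, $a_4=R^6-\frac{55}{174}R^4+\frac{19}{1044}R^2-\frac1{6264}$, $a_5=R^6-\frac{503}{3198}R^4+\frac{25}{6396}R^2-\frac1{115128}$,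 $a_6=R^2(3R^2-1)$, $a_7=-\frac{2665}{1421}R^6+\frac{2515}{8526}R^4-\frac{125}{17052}R^2+\frac5{306936}$, $a_8=\sqrt{3R^4-R^2}$, $a_9=R^2-\frac1{24}$, $a_{10}=660R^4-76R^2+1$, $a_{11}=1980R^6-888R^4+79R^2-1$, $b_1=2i\sqrt{15}\,a_8(3R^2-1)+126R^4+9zR-36R^2$, $b_2=\sqrt{21}(31968R^6-8532R^4+324R^2-1)+a_8(-83160R^4+9576R^2-126)$, $b_3=-\frac{148\sqrt{21}\,a_2a_8a_9}{1155}+R^8-\frac{74}{165}R^6+\frac{79R^4-R^2}{1980}$, $b_4=-\frac{533i\sqrt{35}\,a_1a_5}{1421}+5a_4R^2$, $b_5=a_1R^2\bigl(3i\sqrt{35}\,a_5+\frac{4263a_4}{533}\bigr)$, $b_6=\frac1{220}\bigl(i\sqrt{35}\,a_6^{3/2}a_{10}+19188\sqrt{21}\,a_3a_5R-7308i\sqrt{15}\,a_1a_4R^2\bigr)$, $b_7=15120i\sqrt{15}\,a_6^{3/2}a_{11}-124338240R\bigl(i\sqrt{15}\,a_1R(\sqrt{21}\,a_1a_5-\frac{1036a_2a_8a_9}{533})-\frac{29841a_3a_4R^2}{533}+7\sqrt{21}\,a_3a_5a_8\bigr)$,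 $b_8=\frac{444a_8}{385}\bigl(3i\sqrt{35}\,a_1^2a_2a_9-\frac{29841a_3a_4R}{148}\bigr)$, $b_9=a_8\bigl(-\sqrt{21}\,a_1a_5-\frac{1421i\sqrt{15}\,a_4R^2}{533}\bigr)$, $c_1=-\frac{2993760i\sqrt{15}\,a_1b_3}{b_1b_2}$, $c_2=a_8b_4+a_1R^2(\sqrt{21}\,a_7+i\sqrt{15}\,a_4)$. By a holomorphic branch of $I$ on an open set $U\subseteq\mathbb C^2$ of points $(R,z)$ we mean the function given by this formula with a holomorphic branch on $U$ of $a_8$ (and $a_6^{3/2}=a_8^3$), a holomorphic branch on $U$ of $c_1^{1/3}$, and the analytic continuations of the four hypergeometric series to a common domain $\Omega$ with $0\in\Omega$, $1\notin\Omega$ and $c_1(U)\subseteq\Omega$, where $b_1$, $b_2$, $c_1$ and the denominator of $I$ have no zeros on $U$. (a) The four functions $F$ have principal branches, i.e. analytic continuations to $\mathbb C\setminus[1,\infty)$. (b) Every holomorphic branch $I$ on $U$ is a nondegenerate first integral of (1) and (2): $I$ is holomorphic on $U$, $P\,I_R+Q\,I_z=0$, with $I_z\ne0$ wherever $P\ne0$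 and $I_R\neq0$ wherever $Q\ne0$; and $I$ is constant along each solution $z(R)$ of (1), and along each solution $R(z)$ of (2), that is defined on a connected open subset of $\mathbb C$ and has its graph in $U$. (c) The level sets of $I$ give the local general solution. Let $(R_0,z_0)\in U$ with $P(R_0,z_0)\neq0$. There are open sets $N\ni R_0$ ($N$ connected), $K\ni I(R_0,z_0)$ and $W\subseteq U$ with $(R_0,z_0)\in W$, and a holomorphic function $\varphi:N\times K\to\mathbb C$, such that $(R,C)\mapsto(R,\varphi(R,C))$ maps $N\times K$ bijectively onto $W$ with inverse $(R,z)\mapsto(R,I(R,z))$; $P\ne0$ on $W$; for each constant $C\in K$ the function $z=\varphi(\cdot,C)$ solves (1) on $N$; and every solution of (1) on a nonempty connected open subset of $N$ with graph in $W$ is the restriction of $\varphi(\cdot,C)$ for some $C\in K$. Likewise, near every point of $U$ with $Q\ne0$ the level sets of $I$ are the graphs of the solutions $R=\psi(z,C)$ of (2). (d) Let now all square roots, powers and hypergeometric functions have their principal values, and call a real point $(R,z)$ regular if $b_1,b_2,c_1$ and the denominator of $I$ are nonzero there and $c_1\notin[1,\infty)$. For each real $R$ with $R\ne0$, $3R^2\neq1$,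 the point $(R,z)$ is regular for all real $z$ of sufficiently large absolute value. If $z(R)$ is a real function on an open interval whose graph consists of regular points, then $I$ is constant along the graph if $z$ solves (1); and conversely, if $z$ is continuous, $P\neq0$ on the graph and $I$ is constant along it, then $z$ solves (1). The same holds for real functions $R(z)$ on an open interval and equation (2), with $Q\ne 0$ in place of $P\neq 0$ in the converse. -/

import Mathlib

namespace Kudashev

/-! ### The Abel equation `lead R z * z'(R) = rhs R z` and its reciprocal form for `R(z)` -/

/-- The coefficient of `z'(R)` in the Abel equation of the second kind. -/
def abelLead {K : Type*} [Field K] (R z : K) : K :=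
  486 * R ^ 4 - 171 * R ^ 2 + 5 + 9 * R * z

/-- The right-hand side of the Abel equation of the second kind. -/
def abelRhs {K : Type*} [Field K] (R z : K) : K :=
  972 * R ^ 4 - 162 * R ^ 2 + (1458 * R ^ 3 - 225 * R) * z + 27 * z ^ 2

/-- The denominator of the right-hand side of the equation for `R'(z)`. -/
def odeDen {K : Type*} [Field K] (R z : K) : K :=
  9 * (54 * R ^ 3 - 9 * R + z) * (2 * R + 3 * z)

/-- The right-hand side of the equation for `R'(z)`. -/
def odeRhs {K : Type*} [Field K] (R z : K) : K :=
  (486 * R ^ 4 - 171 * R ^ 2 + 9 * z * R + 5) / odeDen R z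

/-- The two right-hand sides are reciprocal to each other. -/
theorem abelRhs_eq_odeDen {K : Type*} [Field K] (R z : K) : abelRhs R z = odeDen R z := by
  unfold abelRhs odeDen
  ring

/-- `ζ` satisfies the Abel equation at the point `R` (in particular it is differentiable there). -/
def SolvesAbelAt {𝕜 : Type*} [NontriviallyNormedField 𝕜] (ζ : 𝕜 → 𝕜) (R : 𝕜) : Prop :=
  ∃ ζ' : 𝕜, HasDerivAt ζ ζ' R ∧ abelLead R (ζ R) * ζ' = abelRhs R (ζ R)

/-- `ρ` satisfies the equation for `R'(z)` at the point `z`, where the denominator of the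
right-hand side does not vanish. -/
def SolvesOdeAt {𝕜 : Type*} [NontriviallyNormedField 𝕜] (ρ : 𝕜 → 𝕜) (z : 𝕜) : Prop :=
  odeDen (ρ z) z ≠ 0 ∧ HasDerivAt ρ (odeRhs (ρ z) z) z

/-! ### The Gauss hypergeometric function and its analytic continuations -/

/-- `f` is holomorphic on `Ω` and coincides near `0` with the Gauss hypergeometric series
with parameters `a, b; c`.  If `Ω` is a domain that contains `0`, this says that `f` is the
analytic continuation to `Ω` of the Gauss hypergeometric function. -/
def IsHypergeometricOn (Ω : Set ℂ) (a b c : ℂ) (f : ℂ → ℂ) : Prop :=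
  DifferentiableOn ℂ f Ω ∧ ∀ᶠ x in nhds (0 : ℂ), f x = ordinaryHypergeometric a b c x

/-- The complex plane cut along the real half-line `[1, ∞)`. -/
def cutPlane : Set ℂ := {x | 1 - x ∈ Complex.slitPlane}

/-- The principal branch of the Gauss hypergeometric function: the analytic continuation of
the hypergeometric series to the cut plane. Only its values on `cutPlane` are meaningful. -/
noncomputable def hypF (a b c : ℂ) : ℂ → ℂ :=
  Classical.epsilon (IsHypergeometricOn cutPlane a b c)

/-! ### The coefficients

Below `s` stands for the value of `a₈ = √(3R⁴ - R²)` and `κ` for the value of `c₁^(1/3)`.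
Since `a₆ = R² (3R² - 1) = a₈²`, the power `a₆^(3/2)` is `s ^ 3` (for principal values this is
the lemma `a6_cpow_three_halves`). -/

/-- `i √15`. -/
noncomputable def i15 : ℂ := Complex.I * (Real.sqrt 15 : ℂ)

/-- `i √35`. -/
noncomputable def i35 : ℂ := Complex.I * (Real.sqrt 35 : ℂ)

/-- `√21`. -/
noncomputable def r21 : ℂ := (Real.sqrt 21 : ℂ)

noncomputable def a1 (R : ℂ) : ℂ := R ^ 2 - 1 / 3

noncomputable def a2 (R : ℂ) : ℂ := R ^ 4 - 25 / 111 * R ^ 2 + 1 / 1332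

noncomputable def a3 (R z : ℂ) : ℂ := R ^ 3 - 2 * R / 7 + z / 14

noncomputable def a4 (R : ℂ) : ℂ := R ^ 6 - 55 / 174 * R ^ 4 + 19 / 1044 * R ^ 2 - 1 / 6264

noncomputable def a5 (R : ℂ) : ℂ :=
  R ^ 6 - 503 / 3198 * R ^ 4 + 25 / 6396 * R ^ 2 - 1 / 115128

noncomputable def a6 (R : ℂ) : ℂ := R ^ 2 * (3 * R ^ 2 - 1)

noncomputable def a7 (R : ℂ) : ℂ :=
  -(2665 / 1421) * R ^ 6 + 2515 / 8526 * R ^ 4 - 125 / 17052 * R ^ 2 + 5 / 306936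

/-- The principal value of `√(3R⁴ - R²)`. -/
noncomputable def a8 (R : ℂ) : ℂ := (3 * R ^ 4 - R ^ 2) ^ (1 / 2 : ℂ)

noncomputable def a9 (R : ℂ) : ℂ := R ^ 2 - 1 / 24

noncomputable def a10 (R : ℂ) : ℂ := 660 * R ^ 4 - 76 * R ^ 2 + 1

noncomputable def a11 (R : ℂ) : ℂ := 1980 * R ^ 6 - 888 * R ^ 4 + 79 * R ^ 2 - 1

theorem a6_cpow_three_halves (R : ℂ) : a6 R ^ (3 / 2 : ℂ) = a8 R ^ 3 := by
  have h : a6 R = 3 * R ^ 4 - R ^ 2 := by unfold a6; ring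
  rw [h, a8, ← Complex.cpow_nat_mul]
  norm_num

noncomputable def b1 (s R z : ℂ) : ℂ :=
  2 * i15 * s * (3 * R ^ 2 - 1) + 126 * R ^ 4 + 9 * z * R - 36 * R ^ 2

noncomputable def b2 (s R : ℂ) : ℂ :=
  r21 * (31968 * R ^ 6 - 8532 * R ^ 4 + 324 * R ^ 2 - 1)
    + s * (-83160 * R ^ 4 + 9576 * R ^ 2 - 126)

noncomputable def b3 (s R : ℂ) : ℂ :=
  -(148 * r21 * a2 R * s * a9 R / 1155) + R ^ 8 - 74 / 165 * R ^ 6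
    + (79 * R ^ 4 - R ^ 2) / 1980

noncomputable def b4 (R : ℂ) : ℂ :=
  -(533 * i35 * a1 R * a5 R / 1421) + 5 * a4 R * R ^ 2

noncomputable def b5 (R : ℂ) : ℂ :=
  a1 R * R ^ 2 * (3 * i35 * a5 R + 4263 * a4 R / 533)

noncomputable def b6 (s R z : ℂ) : ℂ :=
  1 / 220 * (i35 * s ^ 3 * a10 R + 19188 * r21 * a3 R z * a5 R * R
    - 7308 * i15 * a1 R * a4 R * R ^ 2)

noncomputable def b7 (s R z : ℂ) : ℂ :=
  15120 * i15 * s ^ 3 * a11 R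
    - 124338240 * R * (i15 * a1 R * R * (r21 * a1 R * a5 R - 1036 * a2 R * s * a9 R / 533)
      - 29841 * a3 R z * a4 R * R ^ 2 / 533 + 7 * r21 * a3 R z * a5 R * s)

noncomputable def b8 (s R z : ℂ) : ℂ :=
  444 * s / 385 * (3 * i35 * a1 R ^ 2 * a2 R * a9 R - 29841 * a3 R z * a4 R * R / 148)

noncomputable def b9 (s R : ℂ) : ℂ :=
  s * (-(r21 * a1 R * a5 R) - 1421 * i15 * a4 R * R ^ 2 / 533)

noncomputable def c1 (s R z : ℂ) : ℂ :=
  -(2993760 * i15 * a1 R * b3 s R) / (b1 s R z * b2 s R)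

noncomputable def c2 (s R : ℂ) : ℂ :=
  s * b4 R + a1 R * R ^ 2 * (r21 * a7 R + i15 * a4 R)

/-! ### The integral -/

/-- The numerator of the integral; `F₁`, `F₂` stand for `F(-7/6, -1/6; 2/3; ·)` and
`F(-1/6, 5/6; 5/3; ·)`. -/
noncomputable def integralNum (F₁ F₂ : ℂ → ℂ) (s R z : ℂ) : ℂ :=
  997920 * i15 * (F₁ (c1 s R z) * (a1 R * b6 s R z + b8 s R z)
    + 12789 * F₂ (c1 s R z) * a1 R * c2 s R / 220)

/-- The denominator of the integral; `F₃`, `F₄` stand for `F(-5/6, 1/6; 4/3; ·)` and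
`F(1/6, 7/6; 7/3; ·)`. -/
noncomputable def integralDen (F₃ F₄ : ℂ → ℂ) (s κ R z : ℂ) : ℂ :=
  κ * (F₃ (c1 s R z) * b7 s R z + 77711400 * F₄ (c1 s R z) * a1 R * (b5 R + b9 s R))

/-- `I` is, on the open set `U` of points `(R, z)`, a holomorphic branch of the integral:
it is given by the explicit formula, with some analytic continuation of the hypergeometric
functions to a domain `Ω ∌ 1` around `0` and with some holomorphic branches `s` of `√(3R⁴ - R²)`
and `κ` of `c₁^(1/3)` on `U`; all denominators in the formula are nonzero, as is `c₁`. -/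
def IsIntegralBranch (U : Set (ℂ × ℂ)) (I : ℂ × ℂ → ℂ) : Prop :=
  IsOpen U ∧
  ∃ (Ω : Set ℂ) (F₁ F₂ F₃ F₄ : ℂ → ℂ) (s κ : ℂ × ℂ → ℂ),
    IsOpen Ω ∧ IsPreconnected Ω ∧ (0 : ℂ) ∈ Ω ∧ (1 : ℂ) ∉ Ω ∧
    IsHypergeometricOn Ω (-7 / 6) (-1 / 6) (2 / 3) F₁ ∧
    IsHypergeometricOn Ω (-1 / 6) (5 / 6) (5 / 3) F₂ ∧
    IsHypergeometricOn Ω (-5 / 6) (1 / 6) (4 / 3) F₃ ∧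
    IsHypergeometricOn Ω (1 / 6) (7 / 6) (7 / 3) F₄ ∧
    DifferentiableOn ℂ s U ∧ DifferentiableOn ℂ κ U ∧
    ∀ p ∈ U,
      s p ^ 2 = 3 * p.1 ^ 4 - p.1 ^ 2 ∧
      κ p ^ 3 = c1 (s p) p.1 p.2 ∧
      b1 (s p) p.1 p.2 ≠ 0 ∧ b2 (s p) p.1 ≠ 0 ∧
      c1 (s p) p.1 p.2 ≠ 0 ∧ c1 (s p) p.1 p.2 ∈ Ω ∧
      integralDen F₃ F₄ (s p) (κ p) p.1 p.2 ≠ 0 ∧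
      I p = integralNum F₁ F₂ (s p) p.1 p.2 / integralDen F₃ F₄ (s p) (κ p) p.1 p.2

/-- The denominator of the integral, all branches being the principal ones. -/
noncomputable def principalDen (R z : ℂ) : ℂ :=
  integralDen (hypF (-5 / 6) (1 / 6) (4 / 3)) (hypF (1 / 6) (7 / 6) (7 / 3))
    (a8 R) (c1 (a8 R) R z ^ (1 / 3 : ℂ)) R z

/-- The integral, all branches being the principal ones. -/
noncomputable def principalIntegral (R z : ℂ) : ℂ :=
  integralNum (hypF (-7 / 6) (-1 / 6) (2 / 3)) (hypF (-1 / 6) (5 / 6) (5 / 3)) (a8 R) R z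
    / principalDen R z

/-- The formula with principal branches makes sense at `(R, z)`: its denominators and `c₁` do
not vanish, and `c₁` is not on the cut `[1, ∞)` of the hypergeometric functions. -/
def PrincipalRegular (R z : ℂ) : Prop :=
  b1 (a8 R) R z ≠ 0 ∧ b2 (a8 R) R ≠ 0 ∧ c1 (a8 R) R z ≠ 0 ∧ c1 (a8 R) R z ∈ cutPlane ∧
    principalDen R z ≠ 0

end Kudashev

/-! The formula conceals a Riccati equation. In the variable `c = c1`, put y₁ = F(-7/6,-1/6;2/3;c)
and y₂ = c^(1/3) F(-5/6,1/6;4/3;c). These are the two standard solutions at 0 of one hypergeometric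
equation. The other two functions in the formula are, up to constants, the derivatives of the two
series.

Write s = a₈ and m = s - i√15 R². After cancellation of a common factor (`integralNum_eq`,
`integralDen_eq`) the formula becomes I = L y₁ / (2 L y₂) with L y = s y - 3 m c y'. Thus I = C says
that u = s/(3m) is the logarithmic derivative c y'/y of y = y₁ - 2C y₂, that is, that u solves the
Riccati equation attached to the hypergeometric equation.

The Abel equation is this Riccati equation in other coordinates. Along a vector (v₁, v₂), the
Riccati defect of u, cleared of its denominators, is a nonvanishing multiple of P v₂ - Q v₁
(`flow_identity`). The quotient rule for L y₁ / L y₂ gives the same defect times the Wronskian of y₁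
and y₂ (`reduced_bilinear`), and that Wronskian is explicit (`hypRelations`). Hence dI = H (P dz - Q
dR) with H continuous and nowhere zero (`IsIntegralBranch.hasFDerivAt`). The first-integral
properties follow at once, and the inverse function theorem for (R, z) ↦ (R, I) gives the local
general solution (`exists_level_graphs`).

At real points the radicands may lie on the cuts of the principal roots. Nevertheless the principal
formula agrees, on real points near a regular one, with a holomorphic branch
(`PrincipalRegular.exists_branch`), so the complex results transfer. -/

namespace Kudashev

/-! ### Hypergeometric series inside the unit disc. -/

open scoped Topology
open Filter

/-- The coefficients of the hypergeometric series. -/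
noncomputable def hypCoeff (a b c : ℂ) (n : ℕ) : ℂ :=
  ordinaryHypergeometricCoefficient a b c n

/-- None of the parameters is a nonpositive integer. -/
def NonDegenerate (a b c : ℂ) : Prop := ∀ k : ℕ, (k : ℂ) ≠ -a ∧ (k : ℂ) ≠ -b ∧ (k : ℂ) ≠ -c

theorem NonDegenerate.ne_zero {a b c : ℂ} (h : NonDegenerate a b c) : c ≠ 0 := by
  have := (h 0).2.2
  intro h0
  simp [h0] at this

theorem NonDegenerate.add_ne_zero {a b c : ℂ} (h : NonDegenerate a b c) (n : ℕ) :
    c + n ≠ 0 := by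
  intro h0
  exact (h n).2.2 (by linear_combination h0)

theorem NonDegenerate.succ {a b c : ℂ} (h : NonDegenerate a b c) :
    NonDegenerate (a + 1) (b + 1) (c + 1) := by
  intro k
  obtain ⟨h1, h2, h3⟩ := h (k + 1)
  push_cast at h1 h2 h3
  exact ⟨fun e => h1 (by linear_combination e), fun e => h2 (by linear_combination e),
    fun e => h3 (by linear_combination e)⟩

theorem nonDegenerate_of_ratio {p q r : ℤ} {d : ℕ} (hd : d ≠ 0)
    (hp : ¬ (d : ℤ) ∣ p) (hq : ¬ (d : ℤ) ∣ q) (hr : ¬ (d : ℤ) ∣ r) :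
    NonDegenerate (p / d) (q / d) (r / d) := by
  have key : ∀ (m : ℤ), ¬ (d : ℤ) ∣ m → ∀ k : ℕ, (k : ℂ) ≠ -((m : ℂ) / d) := by
    intro m hm k e
    apply hm
    have hd' : (d : ℂ) ≠ 0 := by exact_mod_cast hd
    refine ⟨-k, ?_⟩
    have : (m : ℂ) = d * (-k) := by
      rw [← neg_div, eq_div_iff hd'] at e
      linear_combination e
    exact_mod_cast this
  exact fun k => ⟨key p hp k, key q hq k, key r hr k⟩

theorem hypCoeff_zero (a b c : ℂ) : hypCoeff a b c 0 = 1 := by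
  simp [hypCoeff, ordinaryHypergeometricCoefficient]

theorem hypCoeff_succ {a b c : ℂ} (h : NonDegenerate a b c) (n : ℕ) :
    hypCoeff a b c (n + 1) * ((n + 1) * (c + n)) = hypCoeff a b c n * ((a + n) * (b + n)) := by
  have hc := h.add_ne_zero n
  have hn : (n : ℂ) + 1 ≠ 0 := by exact_mod_cast n.succ_ne_zero
  simp only [hypCoeff, ordinaryHypergeometricCoefficient, ascPochhammer_succ_eval,
    Nat.factorial_succ, Nat.cast_mul, Nat.cast_add, Nat.cast_one, mul_inv]
  field_simp

theorem hypCoeff_shift {a b c : ℂ} (h : NonDegenerate a b c) (n : ℕ) :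
    hypCoeff a b c (n + 1) * (n + 1) = a * b / c * hypCoeff (a + 1) (b + 1) (c + 1) n := by
  have hc := h.ne_zero
  have hn : (n : ℂ) + 1 ≠ 0 := by exact_mod_cast n.succ_ne_zero
  simp only [hypCoeff, ordinaryHypergeometricCoefficient, ascPochhammer_succ_left,
    Nat.factorial_succ, Nat.cast_mul, Nat.cast_add, Nat.cast_one, mul_inv, Polynomial.eval_mul,
    Polynomial.eval_X, Polynomial.eval_comp, Polynomial.eval_add, Polynomial.eval_one]
  field_simp

theorem hasFPowerSeriesOnBall_hyp {a b c : ℂ} (h : NonDegenerate a b c) :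
    HasFPowerSeriesOnBall (ordinaryHypergeometric a b c : ℂ → ℂ)
      (ordinaryHypergeometricSeries ℂ a b c) 0 1 := by
  have hr := ordinaryHypergeometricSeries_radius_eq_one ℂ a b c h
  have := (ordinaryHypergeometricSeries ℂ a b c).hasFPowerSeriesOnBall (by rw [hr]; simp)
  rwa [hr] at this

theorem mem_eball_one {x : ℂ} (hx : ‖x‖ < 1) : x ∈ Metric.eball (0 : ℂ) 1 := by
  rw [Metric.mem_eball, edist_zero_right, ← ofReal_norm, ← ENNReal.ofReal_one]
  exact (ENNReal.ofReal_lt_ofReal_iff one_pos).2 hx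

theorem hasSum_hyp {a b c : ℂ} (h : NonDegenerate a b c) {x : ℂ} (hx : ‖x‖ < 1) :
    HasSum (fun n => hypCoeff a b c n * x ^ n) (ordinaryHypergeometric a b c x) := by
  have := (hasFPowerSeriesOnBall_hyp h).hasSum (mem_eball_one hx)
  simpa only [ordinaryHypergeometricSeries_apply_eq, zero_add, smul_eq_mul, hypCoeff,
    ordinaryHypergeometricCoefficient] using this

/-- Termwise differentiation; the coefficients match by `hypCoeff_shift`. -/
theorem hasDerivAt_hyp {a b c : ℂ} (h : NonDegenerate a b c) {x : ℂ} (hx : ‖x‖ < 1) :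
    HasDerivAt (ordinaryHypergeometric a b c)
      (a * b / c * ordinaryHypergeometric (a + 1) (b + 1) (c + 1) x) x := by
  have hp := hasFPowerSeriesOnBall_hyp h
  have hmem := mem_eball_one hx
  have hd : DifferentiableAt ℂ (ordinaryHypergeometric a b c : ℂ → ℂ) x :=
    (hp.analyticOnNhd x hmem).differentiableAt
  have h2 := (ContinuousLinearMap.apply ℂ ℂ (1 : ℂ)).hasSum (hp.fderiv.hasSum hmem)
  simp only [ContinuousLinearMap.apply_apply, zero_add, fderiv_apply_one_eq_deriv] at h2
  have h3 := (hasSum_hyp h.succ hx).mul_left (a * b / c)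
  have h4 : deriv (ordinaryHypergeometric a b c) x
      = a * b / c * ordinaryHypergeometric (a + 1) (b + 1) (c + 1) x := by
    refine h2.unique ?_
    convert! h3 using 1
    funext n
    rw [FormalMultilinearSeries.apply_eq_prod_smul_coeff, ← mul_assoc, ← hypCoeff_shift h n]
    simp only [Finset.prod_const, Finset.card_univ, Fintype.card_fin,
      smul_apply, FormalMultilinearSeries.derivSeries_coeff_one,
      ordinaryHypergeometricSeries, FormalMultilinearSeries.coeff_ofScalars,
      smul_eq_mul, nsmul_eq_mul, hypCoeff, ordinaryHypergeometricCoefficient]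
    push_cast
    ring
  rw [← h4]
  exact hd.hasDerivAt

/-- The hypergeometric equation, as a relation between `F(a,b;c)` and `F(a+1,b+1;c+1)`. -/
theorem hyp_contiguous {a b c : ℂ} (h : NonDegenerate a b c) {x : ℂ} (hx : ‖x‖ < 1) :
    x * (1 - x) * deriv (ordinaryHypergeometric (a + 1) (b + 1) (c + 1)) x
      + (c - (a + b + 1) * x) * ordinaryHypergeometric (a + 1) (b + 1) (c + 1) x
      = c * ordinaryHypergeometric a b c x := by
  rw [(hasDerivAt_hyp h.succ hx).deriv]
  have hF := hasSum_hyp h hx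
  have hG := hasSum_hyp h.succ hx
  have hH := hasSum_hyp h.succ.succ hx
  have e : ∀ n : ℕ, hypCoeff (a + 1) (b + 1) (c + 1) (n + 1) * (n + 1) * x ^ (n + 1)
      = x * ((a + 1) * (b + 1) / (c + 1) * (hypCoeff (a + 1 + 1) (b + 1 + 1) (c + 1 + 1) n * x ^ n))
      := by
    intro n
    rw [hypCoeff_shift h.succ n]
    ring
  have hxG : HasSum (fun n : ℕ => hypCoeff (a + 1) (b + 1) (c + 1) n * n * x ^ n)
      (x * ((a + 1) * (b + 1) / (c + 1)
        * ordinaryHypergeometric (a + 1 + 1) (b + 1 + 1) (c + 1 + 1) x)) := by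
    rw [← hasSum_nat_add_iff' 1]
    simpa [e, hypCoeff_zero] using (hH.mul_left ((a + 1) * (b + 1) / (c + 1))).mul_left x
  -- Dropping the constant terms here and in `hC`, and multiplying by x in `hB`, makes all three
  -- series run over x^(n+1), so coefficients can be compared.
  have hA := (hasSum_nat_add_iff' 1).2 (hxG.add (hG.mul_left c))
  have hB := (hxG.add (hG.mul_left (a + b + 1))).mul_left x
  have hC := (hasSum_nat_add_iff' 1).2 (hF.mul_left c)
  have key := (hA.sub hB).unique (hC.congr_fun ?_)
  · simp only [Finset.range_one, Finset.sum_singleton, hypCoeff_zero] at key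
    push_cast at key
    linear_combination key
  · intro n
    have h1 := hypCoeff_succ h.succ n
    have h2 := hypCoeff_shift h n
    have hn : (n : ℂ) + 1 ≠ 0 := by exact_mod_cast n.succ_ne_zero
    have hc := h.ne_zero
    have h3 : hypCoeff (a + 1) (b + 1) (c + 1) (n + 1) * (n + 1 + c)
        - (n + (a + b + 1)) * hypCoeff (a + 1) (b + 1) (c + 1) n = c * hypCoeff a b c (n + 1) := by
      apply mul_right_cancel₀ hn
      rw [mul_assoc c, h2]
      field_simp
      linear_combination h1
    push_cast
    linear_combination x ^ (n + 1) * h3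

end Kudashev

/-! ### Continuation to the cut plane by Euler's integral. -/

namespace Kudashev

open scoped Topology
open Filter MeasureTheory

theorem isOpen_cutPlane : IsOpen cutPlane :=
  Complex.isOpen_slitPlane.preimage (by fun_prop)

theorem zero_mem_cutPlane : (0 : ℂ) ∈ cutPlane := by
  simp [cutPlane]

theorem one_notMem_cutPlane : (1 : ℂ) ∉ cutPlane := by
  simp [cutPlane]

/-- The cut plane is star-shaped about 0. This gives its connectedness and also keeps 1 - xt off the
cut of the power in Euler's integral. -/
theorem real_mul_mem_cutPlane {x : ℂ} (hx : x ∈ cutPlane) {t : ℝ} (h0 : 0 ≤ t) (h1 : t ≤ 1) :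
    x * t ∈ cutPlane := by
  have h : (1 : ℂ) + (-x) ∈ Complex.slitPlane := by simpa [cutPlane, sub_eq_add_neg] using hx
  have := Complex.starConvex_one_slitPlane.add_smul_mem h h0 h1
  change 1 - x * t ∈ Complex.slitPlane
  convert this using 1
  rw [Complex.real_smul]
  ring

theorem isPreconnected_cutPlane : IsPreconnected cutPlane := by
  have : StarConvex ℝ (0 : ℂ) cutPlane := by
    rw [starConvex_zero_iff]
    intro x hx t h0 h1
    have := real_mul_mem_cutPlane hx h0 h1
    rwa [Complex.real_smul, mul_comm]
  exact (this.isPathConnected zero_mem_cutPlane).isConnected.isPreconnected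

/-- The density of the beta integral. -/
noncomputable def betaDensity (u v : ℂ) (t : ℝ) : ℂ := (t : ℂ) ^ (u - 1) * (1 - (t : ℂ)) ^ (v - 1)

/-- The Euler integral for `B(b, d) F(a, b; b + d; x)`. -/
noncomputable def eulerIntegral (a b d x : ℂ) : ℂ :=
  ∫ t in (0 : ℝ)..1, betaDensity b d t * (1 - x * t) ^ (-a)

theorem betaDensity_intervalIntegrable {b d : ℂ} (hb : 0 < b.re) (hd : 0 < d.re) :
    IntervalIntegrable (betaDensity b d) volume 0 1 :=
  Complex.betaIntegral_convergent hb hd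

theorem integral_betaDensity_mul_pow (b d : ℂ) (n : ℕ) :
    ∫ t in (0 : ℝ)..1, betaDensity b d t * (t : ℂ) ^ n = Complex.betaIntegral (b + n) d := by
  refine intervalIntegral.integral_congr_ae (Eventually.of_forall fun t ht => ?_)
  rw [Set.uIoc_of_le zero_le_one] at ht
  have ht0 : (t : ℂ) ≠ 0 := by exact_mod_cast ht.1.ne'
  rw [betaDensity, show b + n - 1 = (b - 1) + n by ring, Complex.cpow_add _ _ ht0,
    Complex.cpow_natCast]
  ring

/-- Both beta values are quotients of Gamma values, and Gamma(z + n)/Gamma(z) is a Pochhammer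
symbol. These ratios turn the binomial coefficients into hypergeometric ones. -/
theorem betaIntegral_add_nat {b d : ℂ} (hb : 0 < b.re) (hd : 0 < d.re) (n : ℕ) :
    Complex.betaIntegral (b + n) d
      = Complex.betaIntegral b d * ((ascPochhammer ℂ n).eval b / (ascPochhammer ℂ n).eval (b + d))
          := by
  have hbd : 0 < (b + d).re := by simpa using add_pos hb hd
  have hne : ∀ {z : ℂ}, 0 < z.re → ∀ k : ℕ, z ≠ -k := by
    intro z hz k e
    rw [e] at hz
    simp at hz
    linarith [(Nat.cast_nonneg k : (0 : ℝ) ≤ k)]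
  have hbn : 0 < (b + n).re := by simpa using add_pos_of_pos_of_nonneg hb (Nat.cast_nonneg n)
  rw [Complex.betaIntegral_eq_Gamma_mul_div _ _ hbn hd, Complex.betaIntegral_eq_Gamma_mul_div _ _
      hb hd,
    ← Complex.Gamma_add_nat_div_Gamma_eq _ (hne hb),
    ← Complex.Gamma_add_nat_div_Gamma_eq _ (hne hbd),
    show b + n + d = b + d + n by ring]
  have h1 := Complex.Gamma_ne_zero_of_re_pos hb
  have h2 := Complex.Gamma_ne_zero_of_re_pos hbd
  field_simp

theorem hasSum_one_sub_cpow (a : ℂ) {y : ℂ} (hy : ‖y‖ < 1) :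
    HasSum (fun n : ℕ => (ascPochhammer ℂ n).eval a / n.factorial * y ^ n) ((1 - y) ^ (-a)) := by
  have h := (Complex.one_div_one_sub_cpow_hasFPowerSeriesOnBall_zero a).hasSum (mem_eball_one hy)
  rw [zero_add, one_div, ← Complex.cpow_neg] at h
  convert! h using 2 with n
  have hn : (n.factorial : ℂ) ≠ 0 := by exact_mod_cast n.factorial_ne_zero
  have := Ring.factorial_nsmul_multichoose_eq_ascPochhammer a n
  rw [Polynomial.ascPochhammer_smeval_eq_eval, nsmul_eq_mul] at this
  rw [FormalMultilinearSeries.ofScalars_apply_eq, ← Ring.multichoose_eq, ← this, smul_eq_mul,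
    mul_div_cancel_left₀ _ hn]

/-- Expand (1 - xt)^(-a) by the binomial series and integrate term by term; the integrable beta
density times a convergent series dominates. -/
theorem eulerIntegral_eq_hyp {a b d : ℂ} (h : NonDegenerate a b (b + d)) (hb : 0 < b.re)
    (hd : 0 < d.re) {x : ℂ} (hx : ‖x‖ < 1) :
    eulerIntegral a b d x = Complex.betaIntegral b d * ordinaryHypergeometric a b (b + d) x := by
  set q : ℕ → ℂ := fun n => (ascPochhammer ℂ n).eval a / n.factorial
  have hsum : HasSum (fun n => ∫ t in (0 : ℝ)..1, betaDensity b d t * (q n * (x * t) ^ n))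
      (eulerIntegral a b d x) := by
    have hs : Summable fun n => ‖q n‖ * ‖x‖ ^ n := by
      have := (hasSum_one_sub_cpow a hx).summable.norm
      simpa [q, norm_mul, norm_pow] using this
    refine intervalIntegral.hasSum_integral_of_dominated_convergence
      (fun n t => ‖betaDensity b d t‖ * (‖q n‖ * ‖x‖ ^ n)) ?_ ?_ ?_ ?_ ?_
    · intro n
      have h1 := (intervalIntegrable_iff.1 (betaDensity_intervalIntegrable hb
          hd)).aestronglyMeasurable
      exact h1.mul (Continuous.aestronglyMeasurable (by fun_prop))
    · refine fun n => Eventually.of_forall fun t ht => ?_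
      rw [Set.uIoc_of_le zero_le_one] at ht
      rw [norm_mul, norm_mul, norm_pow, norm_mul, Complex.norm_real, Real.norm_of_nonneg ht.1.le]
      gcongr
      · exact mul_nonneg (norm_nonneg _) ht.1.le
      exact mul_le_of_le_one_right (norm_nonneg _) ht.2
    · exact Eventually.of_forall fun t _ => hs.mul_left _
    · simp_rw [tsum_mul_left]
      exact (betaDensity_intervalIntegrable hb hd).norm.mul_const _
    · refine Eventually.of_forall fun t ht => ?_
      rw [Set.uIoc_of_le zero_le_one] at ht
      refine (hasSum_one_sub_cpow a ?_).mul_left _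
      rw [norm_mul, Complex.norm_real, Real.norm_of_nonneg ht.1.le]
      exact (mul_le_of_le_one_right (norm_nonneg _) ht.2).trans_lt hx
  refine hsum.unique (((hasSum_hyp h hx).mul_left (Complex.betaIntegral b d)).congr_fun ?_)
  intro n
  have e : ∀ t : ℝ, betaDensity b d t * (q n * (x * t) ^ n)
      = (q n * x ^ n) * (betaDensity b d t * (t : ℂ) ^ n) := fun t => by ring
  simp_rw [e]
  rw [intervalIntegral.integral_const_mul, integral_betaDensity_mul_pow,
    betaIntegral_add_nat hb hd, hypCoeff, ordinaryHypergeometricCoefficient]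
  simp only [q]
  ring

theorem hasDerivAt_one_sub_mul_cpow (a : ℂ) {x : ℂ} {t : ℝ} (h : x * t ∈ cutPlane) :
    HasDerivAt (fun y : ℂ => (1 - y * t) ^ (-a)) (a * t * (1 - x * t) ^ (-a - 1)) x := by
  have h1 : HasDerivAt (fun y : ℂ => 1 - y * t) (-t : ℂ) x := by
    simpa using ((hasDerivAt_id x).mul_const (t : ℂ)).const_sub 1
  convert h1.cpow_const (c := -a) h using 1
  ring

theorem differentiableOn_eulerIntegral (a : ℂ) {b d : ℂ} (hb : 0 < b.re) (hd : 0 < d.re) :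
    DifferentiableOn ℂ (eulerIntegral a b d) cutPlane := by
  intro x₀ hx₀
  obtain ⟨ε, hε, hball⟩ := Metric.nhds_basis_closedBall.mem_iff.1 (isOpen_cutPlane.mem_nhds hx₀)
  have hcut : ∀ x ∈ Metric.closedBall x₀ ε, ∀ t ∈ Set.Icc (0 : ℝ) 1, x * t ∈ cutPlane :=
    fun x hx t ht => real_mul_mem_cutPlane (hball hx) ht.1 ht.2
  have hcont : ∀ e : ℂ, ContinuousOn (fun p : ℂ × ℝ => (1 - p.1 * p.2 : ℂ) ^ e)
      (Metric.closedBall x₀ ε ×ˢ Set.Icc (0 : ℝ) 1) := by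
    intro e
    refine ContinuousOn.cpow_const (by fun_prop) fun p hp => hcut p.1 hp.1 p.2 hp.2
  -- Compactness of ball × [0,1] bounds the differentiated power uniformly, so the derivative of the
  -- integrand is dominated by a multiple of the beta density.
  obtain ⟨M, hM⟩ := ((isCompact_closedBall x₀ ε).prod isCompact_Icc).exists_bound_of_continuousOn
    (hcont (-a - 1))
  have hsl : ∀ e : ℂ, ∀ x ∈ Metric.closedBall x₀ ε,
      ContinuousOn (fun t : ℝ => (1 - x * t : ℂ) ^ e) (Set.uIcc 0 1) := by
    intro e x hx
    rw [Set.uIcc_of_le zero_le_one]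
    exact (hcont e).comp (f := fun t : ℝ => (x, t)) (by fun_prop) fun t ht => ⟨hx, ht⟩
  have hI := betaDensity_intervalIntegrable hb hd
  have hx₀' : x₀ ∈ Metric.closedBall x₀ ε := Metric.mem_closedBall_self hε.le
  have hint : ∀ e : ℂ, ∀ x ∈ Metric.closedBall x₀ ε,
      IntervalIntegrable (fun t : ℝ => betaDensity b d t * (1 - x * t) ^ e) volume 0 1 :=
    fun e x hx => hI.mul_continuousOn (hsl e x hx)
  refine (intervalIntegral.hasDerivAt_integral_of_dominated_loc_of_deriv_le (s :=
      Metric.closedBall x₀ ε)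
    (F' := fun x t => betaDensity b d t * (a * t * (1 - x * t) ^ (-a - 1)))
    (bound := fun t => ‖betaDensity b d t‖ * (‖a‖ * M))
    (Metric.closedBall_mem_nhds x₀ hε) ?_ (hint _ _ hx₀') ?_ ?_ ?_
        ?_).2.differentiableAt.differentiableWithinAt
  · filter_upwards [Metric.closedBall_mem_nhds x₀ hε] with x hx
    exact (intervalIntegrable_iff.1 (hint (-a) x hx)).aestronglyMeasurable
  · refine (intervalIntegrable_iff.1 (hI.mul_continuousOn ?_)).aestronglyMeasurable
    exact ContinuousOn.mul (by fun_prop) (hsl _ _ hx₀')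
  · refine Eventually.of_forall fun t ht x hx => ?_
    rw [Set.uIoc_of_le zero_le_one] at ht
    have h1 := hM (x, t) ⟨hx, Set.Ioc_subset_Icc_self ht⟩
    rw [norm_mul, norm_mul, norm_mul, Complex.norm_real, Real.norm_of_nonneg ht.1.le]
    gcongr
    exact mul_le_of_le_one_right (norm_nonneg _) ht.2
  · exact hI.norm.mul_const _
  · refine Eventually.of_forall fun t ht x hx => ?_
    rw [Set.uIoc_of_le zero_le_one] at ht
    exact (hasDerivAt_one_sub_mul_cpow a (hcut x hx t (Set.Ioc_subset_Icc_self ht))).const_mul _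

/-- Euler's integral continues the hypergeometric function to the cut plane. -/
theorem exists_isHypergeometricOn_of_re_pos {a b c : ℂ} (h : NonDegenerate a b c) (hb : 0 < b.re)
    (hc : b.re < c.re) : ∃ f, IsHypergeometricOn cutPlane a b c f := by
  have hd : 0 < (c - b).re := by simpa using hc
  have hB : Complex.betaIntegral b (c - b) ≠ 0 := by
    rw [Complex.betaIntegral_eq_Gamma_mul_div _ _ hb hd]
    refine div_ne_zero (mul_ne_zero (Complex.Gamma_ne_zero_of_re_pos hb)
      (Complex.Gamma_ne_zero_of_re_pos hd)) (Complex.Gamma_ne_zero_of_re_pos ?_)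
    rw [add_sub_cancel]
    exact hb.trans hc
  refine ⟨fun x => (Complex.betaIntegral b (c - b))⁻¹ * eulerIntegral a b (c - b) x,
    (differentiableOn_eulerIntegral a hb hd).const_mul _, ?_⟩
  filter_upwards [Metric.ball_mem_nhds (0 : ℂ) one_pos] with x hx
  rw [eulerIntegral_eq_hyp (by rwa [add_sub_cancel]) hb hd (by simpa using hx), add_sub_cancel,
    inv_mul_cancel_left₀ hB]

/-- A continuation of `F(a+1,b+1;c+1)` yields one of `F(a,b;c)`. -/
theorem IsHypergeometricOn.lower {Ω : Set ℂ} (hΩ : IsOpen Ω) {a b c : ℂ}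
    (h : NonDegenerate a b c) {f : ℂ → ℂ} (hf : IsHypergeometricOn Ω (a + 1) (b + 1) (c + 1) f) :
    IsHypergeometricOn Ω a b c
      (fun x => (x * (1 - x) * deriv f x + (c - (a + b + 1) * x) * f x) / c) := by
  refine ⟨?_, ?_⟩
  · have h1 := hf.1
    have h2 : DifferentiableOn ℂ (deriv f) Ω := h1.deriv hΩ
    fun_prop
  · filter_upwards [Metric.ball_mem_nhds (0 : ℂ) one_pos, hf.2, hf.2.eventually_nhds] with x hx h1
      h2
    have h3 : deriv f x = deriv (ordinaryHypergeometric (a + 1) (b + 1) (c + 1)) x :=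
      EventuallyEq.deriv_eq h2
    rw [h1, h3, hyp_contiguous h (by simpa using hx), mul_div_cancel_left₀ _ h.ne_zero]

theorem nonDegenerate_F₁ : NonDegenerate (-7 / 6) (-1 / 6) (2 / 3) := by
  convert nonDegenerate_of_ratio (p := -7) (q := -1) (r := 4) (d := 6) (by norm_num) (by norm_num)
    (by norm_num) (by norm_num) using 1 <;> norm_num

theorem nonDegenerate_F₂ : NonDegenerate (-1 / 6) (5 / 6) (5 / 3) := by
  convert nonDegenerate_F₁.succ using 1 <;> norm_num

theorem nonDegenerate_F₃ : NonDegenerate (-5 / 6) (1 / 6) (4 / 3) := by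
  convert nonDegenerate_of_ratio (p := -5) (q := 1) (r := 8) (d := 6) (by norm_num) (by norm_num)
    (by norm_num) (by norm_num) using 1 <;> norm_num

theorem nonDegenerate_F₄ : NonDegenerate (1 / 6) (7 / 6) (7 / 3) := by
  convert nonDegenerate_F₃.succ using 1 <;> norm_num

theorem isHypergeometricOn_hypF {a b c : ℂ} (h : ∃ f, IsHypergeometricOn cutPlane a b c f) :
    IsHypergeometricOn cutPlane a b c (hypF a b c) :=
  Classical.epsilon_spec h

theorem exists_F₂ : ∃ f, IsHypergeometricOn cutPlane (-1 / 6) (5 / 6) (5 / 3) f :=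
  exists_isHypergeometricOn_of_re_pos nonDegenerate_F₂ (by norm_num) (by norm_num)

theorem exists_F₄ : ∃ f, IsHypergeometricOn cutPlane (1 / 6) (7 / 6) (7 / 3) f :=
  exists_isHypergeometricOn_of_re_pos nonDegenerate_F₄ (by norm_num) (by norm_num)

/-- Here b = -1/6 lies outside the range of Euler's integral; the contiguous relation recovers the
function from the one with parameters raised by 1. -/
theorem exists_F₁ : ∃ f, IsHypergeometricOn cutPlane (-7 / 6) (-1 / 6) (2 / 3) f := by
  obtain ⟨f, hf⟩ := exists_F₂
  refine ⟨_, IsHypergeometricOn.lower isOpen_cutPlane nonDegenerate_F₁ (f := f) ?_⟩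
  convert hf using 1 <;> norm_num

theorem exists_F₃ : ∃ f, IsHypergeometricOn cutPlane (-5 / 6) (1 / 6) (4 / 3) f := by
  obtain ⟨f, hf⟩ := exists_F₄
  refine ⟨_, IsHypergeometricOn.lower isOpen_cutPlane nonDegenerate_F₃ (f := f) ?_⟩
  convert hf using 1 <;> norm_num

end Kudashev

/-! ### Differential relations and the Wronskian on a domain. -/

namespace Kudashev

open scoped Topology
open Filter

/-- Identity theorem: both sides are analytic on a connected Ω and agree near 0. The contiguous
relation below is continued in the same way. -/
theorem IsHypergeometricOn.deriv_eq {Ω : Set ℂ} (hΩ : IsOpen Ω) (hc : IsPreconnected Ω)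
    (h0 : (0 : ℂ) ∈ Ω) {a b c : ℂ} (h : NonDegenerate a b c) {f g : ℂ → ℂ}
    (hf : IsHypergeometricOn Ω a b c f) (hg : IsHypergeometricOn Ω (a + 1) (b + 1) (c + 1) g) :
    Set.EqOn (deriv f) (fun x => a * b / c * g x) Ω := by
  have h1 : AnalyticOnNhd ℂ (deriv f) Ω := (hf.1.deriv hΩ).analyticOnNhd hΩ
  have h2 : AnalyticOnNhd ℂ (fun x => a * b / c * g x) Ω := (hg.1.const_mul _).analyticOnNhd hΩ
  refine h1.eqOn_of_preconnected_of_eventuallyEq h2 hc h0 ?_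
  filter_upwards [Metric.ball_mem_nhds (0 : ℂ) one_pos, hf.2.eventually_nhds, hg.2] with x hx e1 e2
  rw [EventuallyEq.deriv_eq e1, (hasDerivAt_hyp h (by simpa using hx)).deriv, e2]

theorem IsHypergeometricOn.contiguous {Ω : Set ℂ} (hΩ : IsOpen Ω) (hc : IsPreconnected Ω)
    (h0 : (0 : ℂ) ∈ Ω) {a b c : ℂ} (h : NonDegenerate a b c) {f g : ℂ → ℂ}
    (hf : IsHypergeometricOn Ω a b c f) (hg : IsHypergeometricOn Ω (a + 1) (b + 1) (c + 1) g) :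
    Set.EqOn (fun x => x * (1 - x) * deriv g x + (c - (a + b + 1) * x) * g x)
      (fun x => c * f x) Ω := by
  have h1 : AnalyticOnNhd ℂ (fun x => x * (1 - x) * deriv g x + (c - (a + b + 1) * x) * g x) Ω := by
    refine DifferentiableOn.analyticOnNhd ?_ hΩ
    have h1 := hg.1
    have h2 : DifferentiableOn ℂ (deriv g) Ω := h1.deriv hΩ
    fun_prop
  have h2 : AnalyticOnNhd ℂ (fun x => c * f x) Ω := (hf.1.const_mul _).analyticOnNhd hΩ
  refine h1.eqOn_of_preconnected_of_eventuallyEq h2 hc h0 ?_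
  filter_upwards [Metric.ball_mem_nhds (0 : ℂ) one_pos, hf.2, hg.2.eventually_nhds, hg.2]
    with x hx e1 e2 e3
  rw [EventuallyEq.deriv_eq e2, e1, e3, hyp_contiguous h (by simpa using hx)]

/-- The differential relations between the four hypergeometric functions of the integral at `x`,
together with their Wronskian. -/
structure HypRelations (F₁ F₂ F₃ F₄ : ℂ → ℂ) (x : ℂ) : Prop where
  hasDerivAt₁ : HasDerivAt F₁ (7 / 24 * F₂ x) x
  hasDerivAt₂ : HasDerivAt F₂ (deriv F₂ x) x
  hasDerivAt₃ : HasDerivAt F₃ (-5 / 48 * F₄ x) x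
  hasDerivAt₄ : HasDerivAt F₄ (deriv F₄ x) x
  eq₂ : x * (1 - x) * deriv F₂ x = 2 / 3 * F₁ x - (2 + x) / 3 * F₂ x
  eq₄ : x * (1 - x) * deriv F₄ x = 4 / 3 * F₃ x - (4 - x) / 3 * F₄ x
  wronskian : F₁ x * F₃ x / 3 - 5 / 48 * x * F₁ x * F₄ x - 7 / 24 * x * F₂ x * F₃ x = (1 - x) / 3

/-- The left side of `wronskian` is x^(2/3) times the Wronskian of F₁ and x^(1/3) F₃. By Abel's
formula it is a multiple of 1 - x; multiplying by x^(2/3) avoids choosing a branch of the root. The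
proof shows that its quotient by 1 - x has zero derivative and reads off 1/3 at 0. -/
theorem hypRelations {Ω : Set ℂ} {F₁ F₂ F₃ F₄ : ℂ → ℂ} (hΩ : IsOpen Ω) (hc : IsPreconnected Ω)
    (h0 : (0 : ℂ) ∈ Ω) (h1 : (1 : ℂ) ∉ Ω)
    (hF₁ : IsHypergeometricOn Ω (-7 / 6) (-1 / 6) (2 / 3) F₁)
    (hF₂ : IsHypergeometricOn Ω (-1 / 6) (5 / 6) (5 / 3) F₂)
    (hF₃ : IsHypergeometricOn Ω (-5 / 6) (1 / 6) (4 / 3) F₃)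
    (hF₄ : IsHypergeometricOn Ω (1 / 6) (7 / 6) (7 / 3) F₄) :
    ∀ x ∈ Ω, HypRelations F₁ F₂ F₃ F₄ x := by
  have hF₂' : IsHypergeometricOn Ω (-7 / 6 + 1) (-1 / 6 + 1) (2 / 3 + 1) F₂ := by
    convert hF₂ using 1 <;> norm_num
  have hF₄' : IsHypergeometricOn Ω (-5 / 6 + 1) (1 / 6 + 1) (4 / 3 + 1) F₄ := by
    convert hF₄ using 1 <;> norm_num
  have hd : ∀ {a b c : ℂ} {f : ℂ → ℂ}, IsHypergeometricOn Ω a b c f → ∀ x ∈ Ω,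
      HasDerivAt f (deriv f x) x :=
    fun hf x hx => (hf.1.differentiableAt (hΩ.mem_nhds hx)).hasDerivAt
  have d1 : ∀ x ∈ Ω, HasDerivAt F₁ (7 / 24 * F₂ x) x := by
    intro x hx
    convert hd hF₁ x hx using 1
    rw [hF₁.deriv_eq hΩ hc h0 nonDegenerate_F₁ hF₂' hx]
    norm_num
  have d3 : ∀ x ∈ Ω, HasDerivAt F₃ (-5 / 48 * F₄ x) x := by
    intro x hx
    convert hd hF₃ x hx using 1
    rw [hF₃.deriv_eq hΩ hc h0 nonDegenerate_F₃ hF₄' hx]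
    norm_num
  have e2 : ∀ x ∈ Ω, x * (1 - x) * deriv F₂ x = 2 / 3 * F₁ x - (2 + x) / 3 * F₂ x := by
    intro x hx
    have := hF₁.contiguous hΩ hc h0 nonDegenerate_F₁ hF₂' hx
    simp only at this
    linear_combination this
  have e4 : ∀ x ∈ Ω, x * (1 - x) * deriv F₄ x = 4 / 3 * F₃ x - (4 - x) / 3 * F₄ x := by
    intro x hx
    have := hF₃.contiguous hΩ hc h0 nonDegenerate_F₃ hF₄' hx
    simp only at this
    linear_combination this
  have hne : ∀ x ∈ Ω, 1 - x ≠ 0 := fun x hx e => h1 (by rwa [← sub_eq_zero.1 e] at hx)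
  have z1 : F₁ 0 = 1 := by rw [hF₁.2.self_of_nhds, ordinaryHypergeometric_zero]
  have z2 : F₂ 0 = 1 := by rw [hF₂.2.self_of_nhds, ordinaryHypergeometric_zero]
  have z3 : F₃ 0 = 1 := by rw [hF₃.2.self_of_nhds, ordinaryHypergeometric_zero]
  have z4 : F₄ 0 = 1 := by rw [hF₄.2.self_of_nhds, ordinaryHypergeometric_zero]
  set Y : ℂ → ℂ := fun x =>
    (F₁ x * F₃ x / 3 - 5 / 48 * x * F₁ x * F₄ x - 7 / 24 * x * F₂ x * F₃ x) / (1 - x) with hY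
  have hYd : ∀ x ∈ Ω, HasDerivAt Y 0 x := by
    intro x hx
    have D1 := d1 x hx
    have D2 := hd hF₂ x hx
    have D3 := d3 x hx
    have D4 := hd hF₄ x hx
    have E2 := e2 x hx
    have E4 := e4 x hx
    have hx1 := hne x hx
    have hi := hasDerivAt_id x
    refine (((((D1.mul D3).div_const 3).sub (((hi.const_mul (5 / 48)).mul D1).mul D4)).sub
      (((hi.const_mul (7 / 24)).mul D2).mul D3)).div (hi.const_sub 1) hx1).congr_deriv ?_
    rw [div_eq_zero_iff]
    left
    simp only [Pi.mul_apply, Pi.sub_apply, id]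
    -- The equations for F₂' and F₄' carry a factor x and give nothing at 0, where the initial
    -- values 1 decide instead.
    by_cases hx0 : x = 0
    · subst hx0
      simp only [z1, z2, z3, z4]
      norm_num
    · apply mul_left_cancel₀ hx0
      linear_combination (-5 / 48 * x * F₁ x) * E4 + (-7 / 24 * x * F₃ x) * E2
  have hYc : ∀ x ∈ Ω, Y x = 1 / 3 := by
    intro x hx
    have : Y x = Y 0 := hΩ.is_const_of_deriv_eq_zero hc
      (fun y hy => (hYd y hy).differentiableAt.differentiableWithinAt)
      (fun y hy => (hYd y hy).deriv) hx h0
    rw [this]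
    simp [hY, z1, z3]
  intro x hx
  refine ⟨d1 x hx, hd hF₂ x hx, d3 x hx, hd hF₄ x hx, e2 x hx, e4 x hx, ?_⟩
  have := hYc x hx
  simp only [hY] at this
  rw [div_eq_iff (hne x hx)] at this
  linear_combination this

end Kudashev

/-! ### Factorization of the coefficients of the integral. -/

namespace Kudashev

theorem i15_sq : i15 ^ 2 = -15 := by
  rw [i15, mul_pow, Complex.I_sq, ← Complex.ofReal_pow, Real.sq_sqrt (by norm_num)]
  norm_num

theorem r21_sq : r21 ^ 2 = 21 := by
  rw [r21, ← Complex.ofReal_pow, Real.sq_sqrt (by norm_num)]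
  norm_num

theorem i35_eq : i35 = i15 * r21 / 3 := by
  have h : Real.sqrt 15 * Real.sqrt 21 = 3 * Real.sqrt 35 := by
    rw [← Real.sqrt_mul (by norm_num), show (15 : ℝ) * 21 = 3 ^ 2 * 35 by norm_num,
      Real.sqrt_mul (by norm_num), Real.sqrt_sq (by norm_num)]
  have h' : (Real.sqrt 15 : ℂ) * (Real.sqrt 21 : ℂ) = 3 * (Real.sqrt 35 : ℂ) := by
    exact_mod_cast h
  rw [i35, i15, r21]
  linear_combination -(Complex.I / 3) * h'

theorem i15_ne_zero : i15 ≠ 0 := by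
  intro h
  have := i15_sq
  rw [h] at this
  norm_num at this

/-- This is the cancellation behind `c1`: the factor b₂ of its denominator also divides its
numerator, leaving 12 i√15 a₁ s / b₁. -/
theorem b3_eq {s R : ℂ} (hs : s ^ 2 = 3 * R ^ 4 - R ^ 2) :
    2993760 * b3 s R = -12 * (s * b2 s R) := by
  unfold b3 b2 a2 a9
  linear_combination (- 997920 * R ^ 4 + 114912 * R ^ 2 - 1512) * hs

/-- The factor `3a₁ - √21 a₈` of the integral. -/
noncomputable def hFactor (s R : ℂ) : ℂ := 3 * a1 R - r21 * s

/-- This and the next three identities factor the coefficients of the four hypergeometric functions.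
They hold modulo s² = 3R⁴ - R², (i√15)² = -15 and (√21)² = 21; the long coefficients are the
cofactors of these three relations. -/
theorem num_coeff₁ {s R : ℂ} (z : ℂ) (hs : s ^ 2 = 3 * R ^ 4 - R ^ 2) :
    a1 R * b6 s R z + b8 s R z = b2 s R * hFactor s R * b1 s R z / 498960 := by
  have hw := i15_sq
  have ht := r21_sq
  unfold b6 b8 b2 hFactor b1 a1 a2 a3 a4 a5 a9 a10
  rw [i35_eq]
  generalize i15 = w at *
  generalize r21 = t at *
  linear_combination (148/385 * w * t ^ 2 * R ^ 8 - 533/2310 * w * t ^ 2 * R ^ 6 + 4/105 * w * t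
      ^ 2 * R ^ 4 - 109/83160 * w * t ^ 2 * R ^ 2 + 1/249480 * w * t ^ 2 + 3 * w * R ^ 8 -
      129/55 * w * R ^ 6 + 25/44 * w * R ^ 4 - 41/990 * w * R ^ 2 + 1/1980 * w - 21 * t * R ^ 8
      + 463/55 * t * R ^ 6 - 3/2 * t * R ^ 5 * z - 159/220 * t * R ^ 4 + 19/110 * t * R ^ 3 * z
      + 1/110 * t * R ^ 2 - 1/440 * t * R * z) * hs
    + (444/385 * w * R ^ 12 - 829/770 * w * R ^ 10 + 797/2310 * w * R ^ 8 - 233/5544 * w * R ^ 6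
      + 1/756 * w * R ^ 4 - 1/249480 * w * R ^ 2 + 444/55 * s * R ^ 10 - 687/154 * s * R ^ 8 +
      222/385 * s * R ^ 7 * z + 537/770 * s * R ^ 6 - 237/1540 * s * R ^ 5 * z - 131/5544 * s *
      R ^ 4 + 9/1540 * s * R ^ 3 * z + 1/13860 * s * R ^ 2 - 1/55440 * s * R * z) * ht

theorem num_coeff₂ {s R : ℂ} (hs : s ^ 2 = 3 * R ^ 4 - R ^ 2) :
    12789 * a1 R * c2 s R / 220
      = -(7 / 24 * (b2 s R * hFactor s R * a1 R * i15 * (s - i15 * R ^ 2)) / 13860) := by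
  have hw := i15_sq
  have ht := r21_sq
  unfold c2 b4 b2 hFactor a1 a4 a5 a7
  rw [i35_eq]
  generalize i15 = w at *
  generalize r21 = t at *
  linear_combination (- 7/4 * w ^ 2 * t * R ^ 8 + 259/330 * w ^ 2 * t * R ^ 6 - 553/7920 * w ^ 2
      * t * R ^ 4 + 7/7920 * w ^ 2 * t * R ^ 2 - 37/55 * w * t ^ 2 * R ^ 8 + 533/1320 * w * t ^
      2 * R ^ 6 - 1/15 * w * t ^ 2 * R ^ 4 + 109/47520 * w * t ^ 2 * R ^ 2 - 1/142560 * w * t ^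
      2 + 7/4 * w * t * s * R ^ 6 - 259/330 * w * t * s * R ^ 4 + 553/7920 * w * t * s * R ^ 2 -
      7/7920 * w * t * s - 21/4 * w * R ^ 8 + 903/220 * w * R ^ 6 - 175/176 * w * R ^ 4 +
      287/3960 * w * R ^ 2 - 7/7920 * w) * hs
    + (37/55 * t ^ 2 * s * R ^ 10 - 533/1320 * t ^ 2 * s * R ^ 8 + 1/15 * t ^ 2 * s * R ^ 6 -
      109/47520 * t ^ 2 * s * R ^ 4 + 1/142560 * t ^ 2 * s * R ^ 2 - 1599/220 * t * R ^ 12 +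
      527/88 * t * R ^ 10 - 4219/2640 * t * R ^ 8 + 257/1760 * t * R ^ 6 - 19/5940 * t * R ^ 4 +
      1/142560 * t * R ^ 2 + 21/4 * s * R ^ 10 - 903/220 * s * R ^ 8 + 175/176 * s * R ^ 6 -
      287/3960 * s * R ^ 4 + 7/7920 * s * R ^ 2) * hw
    + (- 111/55 * w * R ^ 12 + 829/440 * w * R ^ 10 - 797/1320 * w * R ^ 8 + 233/3168 * w * R ^
      6 - 1/432 * w * R ^ 4 + 1/142560 * w * R ^ 2 - 111/11 * s * R ^ 10 + 533/88 * s * R ^ 8 -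
      s * R ^ 6 + 109/3168 * s * R ^ 4 - 1/9504 * s * R ^ 2) * ht

theorem den_coeff₁ {s R : ℂ} (z : ℂ) (hs : s ^ 2 = 3 * R ^ 4 - R ^ 2) :
    b7 s R z = -60 * (b2 s R * (s - r21 * R ^ 2) * b1 s R z) := by
  have hw := i15_sq
  have ht := r21_sq
  unfold b7 b2 b1 a1 a2 a3 a4 a5 a9 a11
  generalize i15 = w at *
  generalize r21 = t at *
  linear_combination (41446080 * w * t * R ^ 8 - 20334240 * w * t * R ^ 6 + 2334960 * w * t * R
      ^ 4 - 54360 * w * t * R ^ 2 + 120 * w * t - 628689600 * R ^ 8 + 252020160 * R ^ 6 -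
      44906400 * R ^ 5 * z - 21636720 * R ^ 4 + 5171040 * R ^ 3 * z + 272160 * R ^ 2 - 68040 * R
      * z) * hs
    + (- 11508480 * w * s * R ^ 10 + 6907680 * w * s * R ^ 8 - 1140480 * w * s * R ^ 6 + 39240 *
      w * s * R ^ 4 - 120 * w * s * R ^ 2 - 241678080 * R ^ 12 + 133552800 * R ^ 10 - 17262720 *
      R ^ 9 * z - 20878560 * R ^ 8 + 4607280 * R ^ 7 * z + 707400 * R ^ 6 - 174960 * R ^ 5 * z -
      2160 * R ^ 4 + 540 * R ^ 3 * z) * ht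

theorem den_coeff₂ {s R : ℂ} (hs : s ^ 2 = 3 * R ^ 4 - R ^ 2) :
    77711400 * (b5 R + b9 s R) = -225 * (b2 s R * hFactor s R * (s - i15 * R ^ 2)) := by
  have hw := i15_sq
  have ht := r21_sq
  unfold b5 b9 b2 hFactor a1 a4 a5
  rw [i35_eq]
  generalize i15 = w at *
  generalize r21 = t at *
  linear_combination (- 18711000 * w * t * R ^ 6 + 2154600 * w * t * R ^ 4 - 28350 * w * t * R ^
      2 - 7192800 * t ^ 2 * R ^ 6 + 1919700 * t ^ 2 * R ^ 4 - 72900 * t ^ 2 * R ^ 2 + 225 * t ^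
      2 + 18711000 * t * s * R ^ 4 - 2154600 * t * s * R ^ 2 + 28350 * t * s - 56133000 * R ^ 6
      + 25174800 * R ^ 4 - 2239650 * R ^ 2 + 28350) * hs
    + (7192800 * w * s * R ^ 8 - 1919700 * w * s * R ^ 6 + 72900 * w * s * R ^ 4 - 225 * w * s *
      R ^ 2 - 21578400 * R ^ 10 + 12951900 * R ^ 8 - 2138400 * R ^ 6 + 73575 * R ^ 4 - 225 * R ^
      2) * ht

end Kudashev

/-! ### The reduced integral and its Riccati equation. -/

namespace Kudashev

open scoped Topology
open Filter

theorem c1_mul_b1 {s R z : ℂ} (hs : s ^ 2 = 3 * R ^ 4 - R ^ 2) (h1 : b1 s R z ≠ 0)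
    (h2 : b2 s R ≠ 0) : c1 s R z * b1 s R z = 12 * i15 * a1 R * s := by
  rw [c1]
  field_simp
  linear_combination (-(i15 * a1 R)) * b3_eq hs

/-- The numerator of the integral without the factor it shares with the denominator. -/
noncomputable def redNum (F₁ F₂ : ℂ → ℂ) (s R c : ℂ) : ℂ :=
  s * F₁ c - 7 / 8 * (s - i15 * R ^ 2) * c * F₂ c

/-- The denominator of the integral without `2κ` and the factor it shares with the numerator. -/
noncomputable def redDen (F₃ F₄ : ℂ → ℂ) (s R c : ℂ) : ℂ :=
  i15 * R ^ 2 * F₃ c + 5 / 16 * (s - i15 * R ^ 2) * c * F₄ c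

/-- The common factor of the numerator and the denominator of the integral. -/
noncomputable def commonFactor (s R z : ℂ) : ℂ :=
  2 * i15 * b2 s R * hFactor s R * b1 s R z / s

theorem integralNum_eq {F₁ F₂ : ℂ → ℂ} {s R z : ℂ} (hs : s ^ 2 = 3 * R ^ 4 - R ^ 2) (h0 : s ≠ 0)
    (h1 : b1 s R z ≠ 0) (h2 : b2 s R ≠ 0) :
    integralNum F₁ F₂ s R z = commonFactor s R z * redNum F₁ F₂ s R (c1 s R z) := by
  have e1 := num_coeff₁ z hs
  have e2 := num_coeff₂ hs
  have e3 := c1_mul_b1 hs h1 h2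
  rw [integralNum, commonFactor, redNum]
  generalize c1 s R z = c at *
  rw [div_mul_eq_mul_div, eq_div_iff h0]
  linear_combination (997920 * i15 * s * F₁ c) * e1 + (997920 * i15 * s * F₂ c) * e2
    + (7 / 4 * i15 * b2 s R * hFactor s R * (s - i15 * R ^ 2) * F₂ c) * e3

/-- `den_coeff₁` contains s - √21 R² instead of `hFactor`; this relation exposes the factor common
to all four coefficients. -/
theorem hFactor_mul {s R : ℂ} (hs : s ^ 2 = 3 * R ^ 4 - R ^ 2) :
    hFactor s R * R ^ 2 = s * (s - r21 * R ^ 2) := by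
  rw [hFactor, a1]
  linear_combination -hs

theorem integralDen_eq {F₃ F₄ : ℂ → ℂ} {s κ R z : ℂ} (hs : s ^ 2 = 3 * R ^ 4 - R ^ 2) (h0 : s ≠ 0)
    (h1 : b1 s R z ≠ 0) (h2 : b2 s R ≠ 0) :
    integralDen F₃ F₄ s κ R z
      = 2 * commonFactor s R z * (κ * redDen F₃ F₄ s R (c1 s R z)) := by
  have e1 := den_coeff₁ z hs
  have e2 := den_coeff₂ hs
  have e3 := c1_mul_b1 hs h1 h2
  have e4 := hFactor_mul hs
  have hw := i15_sq
  rw [integralDen, commonFactor, redDen]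
  generalize c1 s R z = c at *
  rw [mul_div_assoc', div_mul_eq_mul_div, eq_div_iff h0]
  linear_combination κ * ((s * F₃ c) * e1 + (s * a1 R * F₄ c) * e2
    - (5 / 4 * i15 * b2 s R * hFactor s R * (s - i15 * R ^ 2) * F₄ c) * e3
    - (4 * i15 ^ 2 * b2 s R * b1 s R z * F₃ c) * e4
    - (4 * b2 s R * b1 s R z * s * (s - r21 * R ^ 2) * F₃ c
      + 15 * b2 s R * hFactor s R * (s - i15 * R ^ 2) * F₄ c * a1 R * s) * hw)

/-- The derivatives of the coefficients of the reduced integral along a vector `(v₁, v₂)`. -/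
theorem flow_identity {s R z c ds dc v₁ v₂ : ℂ} (hs : s ^ 2 = 3 * R ^ 4 - R ^ 2)
    (hds : s * ds = (6 * R ^ 3 - R) * v₁) (hc : c * b1 s R z = 12 * i15 * a1 R * s)
    (hdc : dc * b1 s R z + c * (2 * i15 * (ds * (3 * R ^ 2 - 1) + s * (6 * R * v₁))
      + 504 * R ^ 3 * v₁ + 9 * (v₂ * R + z * v₁) - 72 * R * v₁)
      = 12 * i15 * (2 * R * v₁ * s + a1 R * ds))
    (h0 : s ≠ 0) (h1 : b1 s R z ≠ 0) :
    (dc * (c * ((7 * (s - i15 * R ^ 2) - 2 * s) * ((s - i15 * R ^ 2) - 2 * s) / 4)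
        - i15 * R ^ 2 * s)
      + 3 * c * (1 - c) * (s * (ds - 2 * i15 * R * v₁) - (s - i15 * R ^ 2) * ds)) * b1 s R z ^ 2
      = 9 * c * i15 * R ^ 3 * s * (abelLead R z * v₂ - abelRhs R z * v₁) := by
  have hw := i15_sq
  -- Only v₁ occurs: the ratio m/s = 1 - i√15 R²/s depends on R alone.
  have hm : s * (s * (ds - 2 * i15 * R * v₁) - (s - i15 * R ^ 2) * ds) = i15 * R ^ 3 * v₁ := by
    linear_combination (-2 * i15 * R * v₁) * hs + (i15 * R ^ 2) * hds
  set B := b1 s R z with hB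
  set dB := 2 * i15 * (ds * (3 * R ^ 2 - 1) + s * (6 * R * v₁))
      + 504 * R ^ 3 * v₁ + 9 * (v₂ * R + z * v₁) - 72 * R * v₁ with hdB
  set m := s - i15 * R ^ 2 with hmdef
  set dm := s * (ds - 2 * i15 * R * v₁) - m * ds
  set e := 12 * i15 * a1 R * s with he
  set X := 12 * i15 * (2 * R * v₁ * s + a1 R * ds) with hX
  set Y := (7 * m - 2 * s) * (m - 2 * s) / 4 with hY
  have hD : dc * B ^ 2 = X * B - e * dB := by linear_combination B * hdc - dB * hc
  -- The claim after the substitutions c = e/B and dc = (XB - e dB)/B² and clearing of denominators: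
  -- a polynomial identity modulo the relations for s², s ds and i√15².
  have key : s * ((X * B - e * dB) * (e * Y - i15 * R ^ 2 * s * B))
      + 3 * e * (B - e) * B * (i15 * R ^ 3 * v₁)
      = s * (9 * e * i15 * R ^ 3 * s * (abelLead R z * v₂ - abelRhs R z * v₁)) := by
    clear hm hD hdc hc
    simp only [hX, hdB, he, hY, hmdef, hB, b1, a1, abelLead, abelRhs]
    generalize i15 = w at *
    linear_combination (v₂ * s * (- 2268 * w ^ 4 * R ^ 9 + 1512 * w ^ 4 * R ^ 7 - 252 * w ^ 4 * R
        ^ 5 + 1620 * w ^ 2 * s ^ 2 *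
      R ^ 5 - 1080 * w ^ 2 * s ^ 2 * R ^ 3 + 180 * w ^ 2 * s ^ 2 * R - 34020 * w ^ 2 * R ^ 9 +
      22680 * w ^ 2 * R ^ 7 - 3780 * w ^ 2 * R ^ 5)
      + v₁ * (- 63504 * w ^ 4 * s * R ^ 11 + 62208 * w ^ 4 * s * R ^ 9 + 2268 * w ^ 4 * s * R ^ 8
          * z -
      18864 * w ^ 4 * s * R ^ 7 + 1584 * w ^ 4 * s * R ^ 5 - 252 * w ^ 4 * s * R ^ 4 * z + 48 * w
      ^ 4 * s * R ^ 3 + 45360 * w ^ 2 * s ^ 3 * R ^ 7 - 45360 * w ^ 2 * s ^ 3 * R ^ 5 - 1620 * w ^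
      2 * s ^ 3 * R ^ 4 * z + 14400 * w ^ 2 * s ^ 3 * R ^ 3 - 1440 * w ^ 2 * s ^ 3 * R + 180 * w ^
      2 * s ^ 3 * z + 381024 * w ^ 2 * s * R ^ 11 - 287064 * w ^ 2 * s * R ^ 9 + 156492 * w ^ 2 *
      s * R ^ 8 * z + 82296 * w ^ 2 * s * R ^ 7 - 85860 * w ^ 2 * s * R ^ 6 * z + 1944 * w ^ 2 * s
      * R ^ 5 * z ^ 2 - 12096 * w ^ 2 * s * R ^ 5 + 10368 * w ^ 2 * s * R ^ 4 * z - 1296 * w ^ 2 *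
      s * R ^ 3 * z ^ 2 + 720 * w ^ 2 * s * R ^ 3)) * hs
      + (v₂ * s * (- 6804 * w ^ 2 * R ^ 13 + 6804 * w ^ 2 * R ^ 11 - 2268 * w ^ 2 * R ^ 9 + 252 *
          w ^ 2 * R ^ 7)
      + v₁ * (36936 * w ^ 2 * s * R ^ 13 + 20412 * w ^ 2 * s * R ^ 12 * z - 31104 * w ^ 2 * s * R
          ^ 11 -
      13608 * w ^ 2 * s * R ^ 10 * z + 7992 * w ^ 2 * s * R ^ 9 + 2268 * w ^ 2 * s * R ^ 8 * z -
      432 * w ^ 2 * s * R ^ 7 - 48 * w ^ 2 * s * R ^ 5)) * hw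
      + ((12 * w * (R ^ 2 - 1 / 3) * (2 * w * s * (3 * R ^ 2 - 1) + 126 * R ^ 4 + 9 * z * R
          - 36 * R ^ 2) - 12 * w * (R ^ 2 - 1 / 3) * s * 2 * w * (3 * R ^ 2 - 1))
        * (12 * w * (R ^ 2 - 1 / 3) * s * ((7 * (s - w * R ^ 2) - 2 * s) * (s - w * R ^ 2 - 2 * s)
            / 4)
          - w * R ^ 2 * s * (2 * w * s * (3 * R ^ 2 - 1) + 126 * R ^ 4 + 9 * z * R
          - 36 * R ^ 2))) * hds
  apply mul_left_cancel₀ (mul_ne_zero h0 h1)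
  linear_combination key + (s * (c * B * Y - i15 * R ^ 2 * s * B)) * hD
    + (s * (X * B - e * dB) * Y) * hc + 3 * c * B * (1 - c) * B ^ 2 * hm
    + (3 * B * (i15 * R ^ 3 * v₁) * (B - c * B - e)) * hc
    - (9 * s * i15 * R ^ 3 * s * (abelLead R z * v₂ - abelRhs R z * v₁)) * hc

/-- The quotient rule for L y₁ / L y₂, the derivative of c^(1/3) giving the last term on the left.
Eliminating f₂' and f₄' by the differential equations leaves a combination of f₁, …, f₄ proportional
to their Wronskian. The cofactor is the Riccati defect of s/(3m) multiplied by 9m², so the statement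
survives at m = 0. -/
theorem reduced_bilinear {f₁ f₂ f₃ f₄ f₂' f₄' c dc s ds m dm : ℂ} (hc1 : 1 - c ≠ 0)
    (E2 : c * (1 - c) * f₂' = 2 / 3 * f₁ - (2 + c) / 3 * f₂)
    (E4 : c * (1 - c) * f₄' = 4 / 3 * f₃ - (4 - c) / 3 * f₄)
    (V : f₁ * f₃ / 3 - 5 / 48 * c * f₁ * f₄ - 7 / 24 * c * f₂ * f₃ = (1 - c) / 3) :
    3 * c * ((ds * f₁ + s * (7 / 24 * f₂ * dc)
          - 7 / 8 * (dm * c * f₂ + m * (dc * f₂ + c * (f₂' * dc))))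
          * ((s - m) * f₃ + 5 / 16 * m * c * f₄)
        - (s * f₁ - 7 / 8 * m * c * f₂) * ((ds - dm) * f₃ + (s - m) * (-5 / 48 * f₄ * dc)
          + 5 / 16 * (dm * c * f₄ + m * (dc * f₄ + c * (f₄' * dc)))))
      - (s * f₁ - 7 / 8 * m * c * f₂) * dc * ((s - m) * f₃ + 5 / 16 * m * c * f₄)
      = dc * (c * ((7 * m - 2 * s) * (m - 2 * s) / 4) - (s - m) * s)
        + 3 * c * (1 - c) * (s * dm - m * ds) := by
  apply mul_left_cancel₀ hc1
  linear_combination (-21 / 8 * m * c * dc * ((s - m) * f₃ + 5 / 16 * m * c * f₄)) * E2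
    - (15 / 16 * m * c * dc * (s * f₁ - 7 / 8 * m * c * f₂)) * E4
    + 3 * (dc * (c * ((7 * m - 2 * s) * (m - 2 * s) / 4) - (s - m) * s)
        + 3 * c * (1 - c) * (s * dm - m * ds)) * V

/-- The derivative of the reduced integral along a curve. -/
theorem hasDerivAt_reduced {F₁ F₂ F₃ F₄ R s κ c : ℂ → ℂ} {τ z v₁ v₂ ds dc dκ : ℂ}
    (hR : HasDerivAt R v₁ τ) (hs : HasDerivAt s ds τ) (hc : HasDerivAt c dc τ)
    (hκ : HasDerivAt κ dκ τ) (hrel : HypRelations F₁ F₂ F₃ F₄ (c τ))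
    (hsq : s τ ^ 2 = 3 * R τ ^ 4 - R τ ^ 2) (hds : s τ * ds = (6 * R τ ^ 3 - R τ) * v₁)
    (hcb : c τ * b1 (s τ) (R τ) z = 12 * i15 * a1 (R τ) * s τ)
    (hdc : dc * b1 (s τ) (R τ) z + c τ * (2 * i15 * (ds * (3 * R τ ^ 2 - 1)
      + s τ * (6 * R τ * v₁)) + 504 * R τ ^ 3 * v₁ + 9 * (v₂ * R τ + z * v₁) - 72 * R τ * v₁)
      = 12 * i15 * (2 * R τ * v₁ * s τ + a1 (R τ) * ds))
    (hdκ : 3 * c τ * dκ = κ τ * dc)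
    (h0 : s τ ≠ 0) (h1 : b1 (s τ) (R τ) z ≠ 0) (hc0 : c τ ≠ 0) (hc1 : c τ ≠ 1) (hκ0 : κ τ ≠ 0)
    (hd : redDen F₃ F₄ (s τ) (R τ) (c τ) ≠ 0) :
    HasDerivAt (fun t => redNum F₁ F₂ (s t) (R t) (c t)
        / (2 * (κ t * redDen F₃ F₄ (s t) (R t) (c t))))
      (3 * i15 * R τ ^ 3 * s τ
          / (2 * b1 (s τ) (R τ) z ^ 2 * κ τ * redDen F₃ F₄ (s τ) (R τ) (c τ) ^ 2)
        * (abelLead (R τ) z * v₂ - abelRhs (R τ) z * v₁)) τ := by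
  have hF₁ := hrel.hasDerivAt₁.comp τ hc
  have hF₂ := hrel.hasDerivAt₂.comp τ hc
  have hF₃ := hrel.hasDerivAt₃.comp τ hc
  have hF₄ := hrel.hasDerivAt₄.comp τ hc
  have hR2 : HasDerivAt (fun t => i15 * R t ^ 2) (i15 * (2 * R τ * v₁)) τ :=
    ((hR.pow 2).const_mul i15).congr_deriv (by push_cast; ring)
  have hm := hs.sub hR2
  have hn := (hs.mul hF₁).sub (((hm.const_mul (7 / 8)).mul hc).mul hF₂)
  have hdd := (hR2.mul hF₃).add (((hm.const_mul (5 / 16)).mul hc).mul hF₄)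
  have hden : 2 * (κ τ * redDen F₃ F₄ (s τ) (R τ) (c τ)) ≠ 0 :=
    mul_ne_zero two_ne_zero (mul_ne_zero hκ0 hd)
  refine (hn.div ((hκ.mul hdd).const_mul 2) hden).congr_deriv ?_
  have flow := flow_identity hsq hds hcb hdc h0 h1
  have bil := reduced_bilinear (s := s τ) (ds := ds) (m := s τ - i15 * R τ ^ 2)
    (dm := ds - 2 * i15 * R τ * v₁) (dc := dc) (sub_ne_zero.2 hc1.symm) hrel.eq₂ hrel.eq₄
    hrel.wronskian
  simp only [Pi.mul_apply, Pi.sub_apply, Pi.add_apply, Function.comp_apply]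
  rw [redDen] at hd hden ⊢
  rw [div_mul_eq_mul_div (3 * i15 * R τ ^ 3 * s τ), div_eq_div_iff (pow_ne_zero 2 hden)
      (mul_ne_zero (mul_ne_zero
    (mul_ne_zero two_ne_zero (pow_ne_zero 2 h1)) hκ0) (pow_ne_zero 2 hd))]
  clear hn hdd hm hR2 hF₁ hF₂ hF₃ hF₄ hR hs hc hκ hsq hds hcb hdc
  generalize F₁ (c τ) = f₁ at *
  generalize F₂ (c τ) = f₂ at *
  generalize F₃ (c τ) = f₃ at *
  generalize F₄ (c τ) = f₄ at *
  generalize deriv F₂ (c τ) = g₂ at *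
  generalize deriv F₄ (c τ) = g₄ at *
  generalize b1 (s τ) (R τ) z = B at *
  generalize abelLead (R τ) z * v₂ - abelRhs (R τ) z * v₁ = G at *
  generalize s τ = s at *
  generalize R τ = R at *
  generalize c τ = c at *
  generalize κ τ = κ at *
  generalize i15 = w at *
  rw [sub_sub_cancel] at bil
  -- The factor 3c is needed because the derivative of κ is known only through 3c dκ = κ dc.
  apply mul_left_cancel₀ (mul_ne_zero three_ne_zero hc0)
  generalize w * R ^ 2 * f₃ + 5 / 16 * (s - w * R ^ 2) * c * f₄ = D at *
  linear_combination (4 * B ^ 2 * κ ^ 2 * D ^ 2) * bil + (4 * κ ^ 2 * D ^ 2) * flow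
    - (4 * B ^ 2 * κ * D ^ 3 * (s * f₁ - 7 / 8 * (s - w * R ^ 2) * c * f₂)) * hdκ

end Kudashev

/-! ### The differential of a holomorphic branch. -/

namespace Kudashev

open scoped Topology
open Filter

theorem differentiableAt_div {E : Type*} [NormedAddCommGroup E] [NormedSpace ℂ E] {f g : E → ℂ}
    {x : E} (hf : DifferentiableAt ℂ f x) (hg : DifferentiableAt ℂ g x) (h : g x ≠ 0) :
    DifferentiableAt ℂ (fun y => f y / g y) x := by
  simp_rw [div_eq_mul_inv]
  exact hf.mul ((differentiableAt_inv h).comp x hg)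

/-- By `b3_eq`, s = 0 forces b₃ = 0 and hence c₁ = 0; R = 0 forces s = 0. -/
theorem ne_zero_of_c1_ne_zero {s R z : ℂ} (hs : s ^ 2 = 3 * R ^ 4 - R ^ 2) (hc : c1 s R z ≠ 0) :
    s ≠ 0 ∧ R ≠ 0 := by
  have h3 : b3 s R ≠ 0 := by
    rintro h
    simp [c1, h] at hc
  have h0 : s ≠ 0 := by
    intro h
    have := b3_eq hs
    rw [mul_eq_zero_of_left h, mul_zero] at this
    exact h3 ((mul_eq_zero.1 this).resolve_left (by norm_num))
  refine ⟨h0, ?_⟩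
  rintro rfl
  exact h0 (by simpa using hs)

/-- A holomorphic branch of the integral has a differential proportional to `P dz - Q dR`. -/
theorem IsIntegralBranch.hasFDerivAt {U : Set (ℂ × ℂ)} {I : ℂ × ℂ → ℂ}
    (h : IsIntegralBranch U I) :
    ∃ H : ℂ × ℂ → ℂ, ∀ p ∈ U, ContinuousAt H p ∧ H p ≠ 0 ∧ HasFDerivAt I (H p • (abelLead p.1 p.2
        • ContinuousLinearMap.snd ℂ ℂ ℂ
      - abelRhs p.1 p.2 • ContinuousLinearMap.fst ℂ ℂ ℂ)) p := by
  obtain ⟨hU, Ω, F₁, F₂, F₃, F₄, s, κ, hΩ, hΩc, hΩ0, hΩ1, hF₁, hF₂, hF₃, hF₄, hs, hκ, hall⟩ := h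
  have hrel := hypRelations hΩ hΩc hΩ0 hΩ1 hF₁ hF₂ hF₃ hF₄
  set C : ℂ × ℂ → ℂ := fun q => c1 (s q) q.1 q.2
  set J : ℂ × ℂ → ℂ := fun q => redNum F₁ F₂ (s q) q.1 (C q)
    / (2 * (κ q * redDen F₃ F₄ (s q) q.1 (C q))) with hJ
  have hred : ∀ q ∈ U, s q ≠ 0 ∧ q.1 ≠ 0 ∧ C q * b1 (s q) q.1 q.2 = 12 * i15 * a1 q.1 * s q
      ∧ κ q ≠ 0 ∧ redDen F₃ F₄ (s q) q.1 (C q) ≠ 0 ∧ I q = J q := by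
    intro q hq
    obtain ⟨e1, e2, e3, e4, e5, e6, e7, e8⟩ := hall q hq
    obtain ⟨h0, hR⟩ := ne_zero_of_c1_ne_zero e1 e5
    rw [integralDen_eq e1 h0 e3 e4] at e7 e8
    rw [integralNum_eq e1 h0 e3 e4] at e8
    obtain ⟨f1, f2⟩ := mul_ne_zero_iff.1 e7
    obtain ⟨f3, f4⟩ := mul_ne_zero_iff.1 f2
    obtain ⟨_, f5⟩ := mul_ne_zero_iff.1 f1
    refine ⟨h0, hR, c1_mul_b1 e1 e3 e4, f3, f4, ?_⟩
    rw [e8, hJ, mul_comm 2 (commonFactor _ _ _), mul_assoc, mul_div_mul_left _ _ f5]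
  refine ⟨fun p => 3 * i15 * p.1 ^ 3 * s p
    / (2 * b1 (s p) p.1 p.2 ^ 2 * κ p * redDen F₃ F₄ (s p) p.1 (C p) ^ 2), fun p hp => ?_⟩
  have hpU := hU.mem_nhds hp
  have hsd := hs.differentiableAt hpU
  have hκd := hκ.differentiableAt hpU
  have ev := hU.eventually_mem hp
  obtain ⟨hsq, hκ3, hb1, hb2, hc0, hcΩ, -, -⟩ := hall p hp
  obtain ⟨h0, hR0, hcb, hκ0, hden, -⟩ := hred p hp
  have hb1d : DifferentiableAt ℂ (fun q : ℂ × ℂ => b1 (s q) q.1 q.2) p := by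
    unfold b1
    fun_prop
  have ha1d : DifferentiableAt ℂ (fun q : ℂ × ℂ => 12 * i15 * a1 q.1 * s q) p := by
    unfold a1
    fun_prop
  have hCd : DifferentiableAt ℂ C p := by
    refine (differentiableAt_div ha1d hb1d hb1).congr_of_eventuallyEq ?_
    filter_upwards [ev] with q hq
    exact (eq_div_iff (hall q hq).2.2.1).2 (hred q hq).2.2.1
  have hr : HypRelations F₁ F₂ F₃ F₄ (C p) := hrel _ hcΩ
  have g1 := hr.hasDerivAt₁.differentiableAt
  have g2 := hr.hasDerivAt₂.differentiableAt
  have g3 := hr.hasDerivAt₃.differentiableAt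
  have g4 := hr.hasDerivAt₄.differentiableAt
  have hnumd : DifferentiableAt ℂ (fun q => redNum F₁ F₂ (s q) q.1 (C q)) p := by
    clear_value C
    unfold redNum
    fun_prop
  have hdend : DifferentiableAt ℂ (fun q => redDen F₃ F₄ (s q) q.1 (C q)) p := by
    clear_value C
    unfold redDen
    fun_prop
  have hJd : DifferentiableAt ℂ J p :=
    differentiableAt_div hnumd ((hκd.mul hdend).const_mul 2)
      (mul_ne_zero two_ne_zero (mul_ne_zero hκ0 hden))
  have hH0 : 2 * b1 (s p) p.1 p.2 ^ 2 * κ p * redDen F₃ F₄ (s p) p.1 (C p) ^ 2 ≠ 0 :=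
    mul_ne_zero (mul_ne_zero (mul_ne_zero two_ne_zero (pow_ne_zero 2 hb1)) hκ0)
      (pow_ne_zero 2 hden)
  refine ⟨?_, div_ne_zero (mul_ne_zero (mul_ne_zero (mul_ne_zero three_ne_zero i15_ne_zero)
      (pow_ne_zero 3 hR0)) h0) hH0, ?_⟩
  · have hN : DifferentiableAt ℂ (fun q : ℂ × ℂ => 3 * i15 * q.1 ^ 3 * s q) p := by fun_prop
    exact (differentiableAt_div hN ((((hb1d.fun_pow 2).const_mul 2).mul hκd).mul
      (hdend.fun_pow 2)) hH0).continuousAt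
  have hIJ : I =ᶠ[𝓝 p] J := by
    filter_upwards [ev] with q hq using (hred q hq).2.2.2.2.2
  refine HasFDerivAt.congr_of_eventuallyEq ?_ hIJ
  refine hJd.hasFDerivAt.congr_fderiv (ContinuousLinearMap.ext fun v => ?_)
  -- The differential is tested on each vector v along the line p + τv. The derivatives of s, κ and
  -- c₁ are then found by differentiating s² = 3R⁴ - R², κ³ = c₁ and c₁ b₁ = 12 i√15 a₁ s.
  have hγ : HasDerivAt (fun τ : ℂ => p + τ • v) v 0 := by
    simpa using ((hasDerivAt_id (0 : ℂ)).smul_const v).const_add p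
  have line : ∀ {g : ℂ × ℂ → ℂ}, DifferentiableAt ℂ g p →
      HasDerivAt (fun τ : ℂ => g (p + τ • v)) (fderiv ℂ g p v) 0 := by
    intro g hg
    have hg' : HasFDerivAt g (fderiv ℂ g p) ((fun τ : ℂ => p + τ • v) 0) := by
      simpa using hg.hasFDerivAt
    exact hg'.comp_hasDerivAt 0 hγ
  have evτ : ∀ᶠ τ : ℂ in 𝓝 0, p + τ • v ∈ U := by
    have : Tendsto (fun τ : ℂ => p + τ • v) (𝓝 0) (𝓝 p) := by
      simpa using hγ.continuousAt.tendsto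
    exact this.eventually ev
  have dR : HasDerivAt (fun τ : ℂ => (p + τ • v).1) v.1 0 :=
    hasFDerivAt_fst.comp_hasDerivAt (0 : ℂ) hγ
  have dz : HasDerivAt (fun τ : ℂ => (p + τ • v).2) v.2 0 :=
    hasFDerivAt_snd.comp_hasDerivAt (0 : ℂ) hγ
  have ds := line hsd
  have dκ := line hκd
  have dC := line hCd
  have hds : s p * fderiv ℂ s p v = (6 * p.1 ^ 3 - p.1) * v.1 := by
    have l := ds.pow 2
    have r := ((dR.pow 4).const_mul 3).sub (dR.pow 2)
    have e := l.unique (r.congr_of_eventuallyEq (by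
      filter_upwards [evτ] with τ hτ using (hall _ hτ).1))
    simp only [zero_smul, add_zero] at e
    norm_num at e
    linear_combination e / 2
  have hdκ : 3 * C p * fderiv ℂ κ p v = κ p * fderiv ℂ C p v := by
    have l := dκ.pow 3
    have e := l.unique (dC.congr_of_eventuallyEq (by
      filter_upwards [evτ] with τ hτ using (hall _ hτ).2.1))
    simp only [zero_smul, add_zero] at e
    norm_num at e
    have e3 : κ p ^ 3 = C p := hκ3
    linear_combination κ p * e - 3 * fderiv ℂ κ p v * e3
  have hdC : fderiv ℂ C p v * b1 (s p) p.1 p.2 + C p * (2 * i15 * (fderiv ℂ s p v * (3 * p.1 ^ 2 -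
      1)
      + s p * (6 * p.1 * v.1)) + 504 * p.1 ^ 3 * v.1 + 9 * (v.2 * p.1 + p.2 * v.1) - 72 * p.1 * v.1)
      = 12 * i15 * (2 * p.1 * v.1 * s p + a1 p.1 * fderiv ℂ s p v) := by
    have db : HasDerivAt (fun τ : ℂ => b1 (s (p + τ • v)) (p + τ • v).1 (p + τ • v).2) _ 0 :=
      ((((ds.const_mul (2 * i15)).mul (((dR.pow 2).const_mul 3).sub_const 1)).add
        ((dR.pow 4).const_mul 126)).add ((dz.const_mul 9).mul dR)).sub ((dR.pow 2).const_mul 36)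
    have da : HasDerivAt (fun τ : ℂ => 12 * i15 * a1 (p + τ • v).1 * s (p + τ • v)) _ 0 :=
      ((((dR.pow 2).sub_const (1 / 3)).const_mul (12 * i15)).mul ds)
    have e := (dC.mul db).unique (da.congr_of_eventuallyEq (by
      filter_upwards [evτ] with τ hτ using (hred _ hτ).2.2.1))
    simp only [zero_smul, add_zero, Pi.pow_apply] at e
    norm_num at e
    rw [a1]
    linear_combination e
  have main := hasDerivAt_reduced (F₁ := F₁) (F₂ := F₂) (F₃ := F₃) (F₄ := F₄) (z := p.2) (v₂ := v.2)
    dR ds dC dκ (by simpa using hr) (by simpa using hsq) (by simpa using hds) (by simpa using hcb)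
    (by simpa using hdC) (by simpa using hdκ) (by simpa using h0) (by simpa using hb1)
    (by simpa using hc0) (by simpa using ne_of_mem_of_not_mem hcΩ hΩ1) (by simpa using hκ0)
    (by simpa using hden)
  rw [(line hJd).unique main]
  simp

end Kudashev

/-! ### Level sets of the integral as local general solutions. -/

namespace Kudashev

open scoped Topology
open Filter

/-- The linear map `(x, y) ↦ (x, α x + β y)` as an equivalence. -/
noncomputable def shearEquiv (α β : ℂ) (hβ : β ≠ 0) : (ℂ × ℂ) ≃L[ℂ] (ℂ × ℂ) :=
  ContinuousLinearEquiv.equivOfInverse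
    ((ContinuousLinearMap.fst ℂ ℂ ℂ).prod
      (α • ContinuousLinearMap.fst ℂ ℂ ℂ + β • ContinuousLinearMap.snd ℂ ℂ ℂ))
    ((ContinuousLinearMap.fst ℂ ℂ ℂ).prod
      (β⁻¹ • (ContinuousLinearMap.snd ℂ ℂ ℂ - α • ContinuousLinearMap.fst ℂ ℂ ℂ)))
    (fun v => by ext <;> simp [hβ])
    (fun v => by ext <;> simp [hβ])

/-- The level sets of a function with nonvanishing second partial derivative are locally graphs. -/
theorem exists_level_graphs {V : Set (ℂ × ℂ)} {G α β : ℂ × ℂ → ℂ} (hV : IsOpen V)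
    (hα : ∀ p ∈ V, ContinuousAt α p) (hβ : ∀ p ∈ V, ContinuousAt β p) (hβ0 : ∀ p ∈ V, β p ≠ 0)
    (hG : ∀ p ∈ V, HasFDerivAt G
      (α p • ContinuousLinearMap.fst ℂ ℂ ℂ + β p • ContinuousLinearMap.snd ℂ ℂ ℂ) p)
    {x₀ y₀ : ℂ} (h₀ : (x₀, y₀) ∈ V) :
    ∃ (N K : Set ℂ) (W : Set (ℂ × ℂ)) (φ : ℂ → ℂ → ℂ),
      IsOpen N ∧ IsPreconnected N ∧ x₀ ∈ N ∧ IsOpen K ∧ G (x₀, y₀) ∈ K ∧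
      IsOpen W ∧ (x₀, y₀) ∈ W ∧ W ⊆ V ∧
      DifferentiableOn ℂ (fun q : ℂ × ℂ => φ q.1 q.2) (N ×ˢ K) ∧
      (∀ x ∈ N, ∀ C ∈ K, (x, φ x C) ∈ W ∧ G (x, φ x C) = C ∧
        HasDerivAt (fun x' => φ x' C) (-α (x, φ x C) / β (x, φ x C)) x) ∧
      (∀ x y : ℂ, (x, y) ∈ W → x ∈ N ∧ G (x, y) ∈ K ∧ φ x (G (x, y)) = y) := by
  set Φ : ℂ × ℂ → ℂ × ℂ := fun q => (q.1, G q)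
  have hd : ∀ p (hp : p ∈ V), HasFDerivAt Φ
      (shearEquiv (α p) (β p) (hβ0 p hp) : ℂ × ℂ →L[ℂ] ℂ × ℂ) p :=
    fun p hp => hasFDerivAt_fst.prodMk (hG p hp)
  -- Continuity of α and β upgrades differentiability to strict differentiability, as the inverse
  -- function theorem requires.
  have hstrict : HasStrictFDerivAt Φ
      (shearEquiv (α (x₀, y₀)) (β (x₀, y₀)) (hβ0 _ h₀) : ℂ × ℂ →L[ℂ] ℂ × ℂ) (x₀, y₀) := by
    refine HasStrictFDerivAt.prodMk hasStrictFDerivAt_fst ?_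
    refine hasStrictFDerivAt_of_hasFDerivAt_of_continuousAt (f' := fun p =>
      α p • ContinuousLinearMap.fst ℂ ℂ ℂ + β p • ContinuousLinearMap.snd ℂ ℂ ℂ) ?_ ?_
    · filter_upwards [hV.mem_nhds h₀] with p hp using hG p hp
    · exact ((hα _ h₀).smul continuousAt_const).add ((hβ _ h₀).smul continuousAt_const)
  set e := hstrict.toOpenPartialHomeomorph Φ
  have hsrc : (x₀, y₀) ∈ e.source := hstrict.mem_toOpenPartialHomeomorph_source
  have hT : IsOpen (e.target ∩ e.symm ⁻¹' V) := e.isOpen_inter_preimage_symm hV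
  have hmem : (x₀, G (x₀, y₀)) ∈ e.target ∩ e.symm ⁻¹' V := by
    have h1 := e.map_source hsrc
    have h2 := e.left_inv hsrc
    refine ⟨h1, ?_⟩
    change e.symm (e (x₀, y₀)) ∈ V
    rwa [h2]
  -- A product of balls N × K inside the target makes φ defined for all pairs (x, C) at once, with N
  -- connected.
  obtain ⟨ε, hε, hball⟩ := Metric.isOpen_iff.1 hT _ hmem
  rw [← ball_prod_same] at hball
  set N := Metric.ball x₀ ε
  set K := Metric.ball (G (x₀, y₀)) ε
  have hx : x₀ ∈ N := Metric.mem_ball_self hε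
  have hC : G (x₀, y₀) ∈ K := Metric.mem_ball_self hε
  have hopen : IsOpen (N ×ˢ K) := Metric.isOpen_ball.prod Metric.isOpen_ball
  have hsymm : ∀ q ∈ N ×ˢ K, e.symm q ∈ e.source ∧ e.symm q ∈ V ∧ (e.symm q).1 = q.1 ∧
      G (e.symm q) = q.2 := by
    intro q hq
    obtain ⟨h1, h2⟩ := hball hq
    have h3 : Φ (e.symm q) = q := e.right_inv h1
    exact ⟨e.map_target h1, h2, (Prod.ext_iff.1 h3).1, (Prod.ext_iff.1 h3).2⟩
  have hpair : ∀ x ∈ N, ∀ C ∈ K, (x, (e.symm (x, C)).2) = e.symm (x, C) := fun x hx C hC =>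
    Prod.ext (hsymm (x, C) ⟨hx, hC⟩).2.2.1.symm rfl
  have hsd : ∀ q (hq : q ∈ N ×ˢ K), HasFDerivAt e.symm ((shearEquiv (α (e.symm q)) (β (e.symm q))
      (hβ0 _ (hsymm q hq).2.1)).symm : ℂ × ℂ →L[ℂ] ℂ × ℂ) q :=
    fun q hq => e.hasFDerivAt_symm (hball hq).1 (hd _ (hsymm q hq).2.1)
  refine ⟨N, K, e.source ∩ V ∩ (e.source ∩ e ⁻¹' (N ×ˢ K)), fun x C => (e.symm (x, C)).2,
    Metric.isOpen_ball, (convex_ball _ _).isPreconnected, hx, Metric.isOpen_ball, hC,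
    (e.open_source.inter hV).inter (e.isOpen_inter_preimage hopen), ?_, fun q hq => hq.1.2,
    ?_, ?_, ?_⟩
  · exact ⟨⟨hsrc, h₀⟩, hsrc, hx, hC⟩
  · intro q hq
    exact (hsd q hq).snd.differentiableAt.differentiableWithinAt
  · intro x hx C hC
    obtain ⟨h1, h2, h3, h4⟩ := hsymm (x, C) ⟨hx, hC⟩
    simp only [hpair x hx C hC]
    refine ⟨⟨⟨h1, h2⟩, h1, ?_⟩, h4, ?_⟩
    · change Φ (e.symm (x, C)) ∈ N ×ˢ K
      rw [show Φ (e.symm (x, C)) = (x, C) from e.right_inv (hball ⟨hx, hC⟩).1]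
      exact ⟨hx, hC⟩
    · have hline : HasDerivAt (fun x' : ℂ => (x', C)) ((1 : ℂ), (0 : ℂ)) x :=
        (hasDerivAt_id x).prodMk (hasDerivAt_const x C)
      have := (hsd (x, C) ⟨hx, hC⟩).snd.comp_hasDerivAt x hline
      refine this.congr_deriv ?_
      simp [shearEquiv, ContinuousLinearEquiv.symm_equivOfInverse]
      ring
  · rintro x y ⟨⟨h1, h2⟩, _, h3⟩
    have h4 : e.symm (x, G (x, y)) = (x, y) := e.left_inv h1
    exact ⟨h3.1, h3.2, congrArg Prod.snd h4⟩

theorem continuous_abelLead : Continuous fun p : ℂ × ℂ => abelLead p.1 p.2 := by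
  unfold abelLead
  fun_prop

theorem continuous_abelRhs : Continuous fun p : ℂ × ℂ => abelRhs p.1 p.2 := by
  unfold abelRhs
  fun_prop

theorem odeRhs_eq {K : Type*} [Field K] (R z : K) : odeRhs R z = abelLead R z / odeDen R z := by
  unfold odeRhs abelLead
  ring

/-- The derivative of the integral along a curve. -/
theorem hasDerivAt_comp_curve {I : ℂ × ℂ → ℂ} {H R z v w τ : ℂ} {ρ ζ : ℂ → ℂ}
    (hI : HasFDerivAt I (H • (abelLead R z • ContinuousLinearMap.snd ℂ ℂ ℂ
      - abelRhs R z • ContinuousLinearMap.fst ℂ ℂ ℂ)) (R, z))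
    (hρ : HasDerivAt ρ v τ) (hζ : HasDerivAt ζ w τ) (hR : ρ τ = R) (hz : ζ τ = z) :
    HasDerivAt (fun t => I (ρ t, ζ t)) (H * (abelLead R z * w - abelRhs R z * v)) τ := by
  subst hR hz
  have := HasFDerivAt.comp_hasDerivAt (f := fun t => (ρ t, ζ t)) τ hI (hρ.prodMk hζ)
  exact this.congr_deriv (by simp)

theorem IsIntegralBranch.const_of_solvesAbelAt {U : Set (ℂ × ℂ)} {I : ℂ × ℂ → ℂ}
    (h : IsIntegralBranch U I) {N : Set ℂ} {ζ : ℂ → ℂ} (hN : IsOpen N) (hc : IsPreconnected N)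
    (hζ : ∀ R ∈ N, (R, ζ R) ∈ U ∧ SolvesAbelAt ζ R) : ∃ C : ℂ, ∀ R ∈ N, I (R, ζ R) = C := by
  obtain ⟨H, hH⟩ := h.hasFDerivAt
  have hd : ∀ R ∈ N, HasDerivAt (fun R => I (R, ζ R)) 0 R := by
    intro R hR
    obtain ⟨hU, ζ', h1, h2⟩ := hζ R hR
    refine (hasDerivAt_comp_curve (hH _ hU).2.2 (hasDerivAt_id R) h1 rfl rfl).congr_deriv ?_
    rw [h2]
    ring
  exact hN.exists_is_const_of_deriv_eq_zero hc
    (fun R hR => (hd R hR).differentiableAt.differentiableWithinAt) fun R hR => (hd R hR).deriv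

theorem IsIntegralBranch.const_of_solvesOdeAt {U : Set (ℂ × ℂ)} {I : ℂ × ℂ → ℂ}
    (h : IsIntegralBranch U I) {N : Set ℂ} {ρ : ℂ → ℂ} (hN : IsOpen N) (hc : IsPreconnected N)
    (hρ : ∀ z ∈ N, (ρ z, z) ∈ U ∧ SolvesOdeAt ρ z) : ∃ C : ℂ, ∀ z ∈ N, I (ρ z, z) = C := by
  obtain ⟨H, hH⟩ := h.hasFDerivAt
  have hd : ∀ z ∈ N, HasDerivAt (fun z => I (ρ z, z)) 0 z := by
    intro z hz
    obtain ⟨hU, h1, h2⟩ := hρ z hz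
    refine (hasDerivAt_comp_curve (hH _ hU).2.2 h2 (hasDerivAt_id z) rfl rfl).congr_deriv ?_
    rw [abelRhs_eq_odeDen, odeRhs_eq, mul_div_cancel₀ _ h1]
    ring
  exact hN.exists_is_const_of_deriv_eq_zero hc
    (fun R hR => (hd R hR).differentiableAt.differentiableWithinAt) fun R hR => (hd R hR).deriv

/-- On a level graph the slope is -I_R/I_z = Q/P, since H cancels. Conversely I is constant along
any solution, and the inverse of (R, z) ↦ (R, I) then identifies that solution with a level graph.
-/
theorem IsIntegralBranch.exists_abel_solutions {U : Set (ℂ × ℂ)} {I : ℂ × ℂ → ℂ}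
    (h : IsIntegralBranch U I) {R₀ z₀ : ℂ} (h₀ : (R₀, z₀) ∈ U) (hP : abelLead R₀ z₀ ≠ 0) :
    ∃ (N K : Set ℂ) (W : Set (ℂ × ℂ)) (φ : ℂ → ℂ → ℂ),
      IsOpen N ∧ IsPreconnected N ∧ R₀ ∈ N ∧ IsOpen K ∧ I (R₀, z₀) ∈ K ∧
      IsOpen W ∧ (R₀, z₀) ∈ W ∧ W ⊆ U ∧
      DifferentiableOn ℂ (fun q : ℂ × ℂ => φ q.1 q.2) (N ×ˢ K) ∧
      (∀ R ∈ N, ∀ C ∈ K, (R, φ R C) ∈ W ∧ I (R, φ R C) = C ∧ abelLead R (φ R C) ≠ 0 ∧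
        SolvesAbelAt (fun R' => φ R' C) R) ∧
      (∀ R z : ℂ, (R, z) ∈ W → R ∈ N ∧ I (R, z) ∈ K ∧ φ R (I (R, z)) = z) ∧
      (∀ (N' : Set ℂ) (ζ : ℂ → ℂ), N' ⊆ N → IsOpen N' → IsPreconnected N' → N'.Nonempty →
        (∀ R ∈ N', (R, ζ R) ∈ W ∧ SolvesAbelAt ζ R) → ∃ C ∈ K, ∀ R ∈ N', ζ R = φ R C) := by
  obtain ⟨H, hH⟩ := h.hasFDerivAt
  have hV : IsOpen (U ∩ {p : ℂ × ℂ | abelLead p.1 p.2 ≠ 0}) :=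
    h.1.inter (isOpen_ne_fun continuous_abelLead continuous_const)
  obtain ⟨N, K, W, φ, hN, hNc, hRN, hK, hIK, hW, hpW, hWV, hφ, hgr, hinv⟩ :=
    exists_level_graphs (G := I) (α := fun p => -(H p * abelRhs p.1 p.2))
      (β := fun p => H p * abelLead p.1 p.2) hV
      (fun p hp => ((hH p hp.1).1.mul continuous_abelRhs.continuousAt).neg)
      (fun p hp => (hH p hp.1).1.mul continuous_abelLead.continuousAt)
      (fun p hp => mul_ne_zero (hH p hp.1).2.1 hp.2)
      (fun p hp => by
        exact (hH p hp.1).2.2.congr_fderiv (by ext <;> simp)) (x₀ := R₀) (y₀ := z₀) ⟨h₀, hP⟩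
  refine ⟨N, K, W, φ, hN, hNc, hRN, hK, hIK, hW, hpW, fun p hp => (hWV hp).1, hφ, ?_, hinv, ?_⟩
  · intro R hR C hC
    obtain ⟨h1, h2, h3⟩ := hgr R hR C hC
    have h4 : abelLead R (φ R C) ≠ 0 := (hWV h1).2
    have h5 := (hH _ (hWV h1).1).2.1
    refine ⟨h1, h2, h4, _, h3, ?_⟩
    simp only
    field_simp
  · intro N' ζ hN' ho hc ⟨R, hR⟩ hsol
    obtain ⟨C, hC⟩ := h.const_of_solvesAbelAt ho hc
      fun R hR => ⟨(hWV (hsol R hR).1).1, (hsol R hR).2⟩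
    refine ⟨C, hC R hR ▸ (hinv R _ (hsol R hR).1).2.1, fun R' hR' => ?_⟩
    rw [← hC R' hR', (hinv R' _ (hsol R' hR').1).2.2]

theorem IsIntegralBranch.exists_ode_solutions {U : Set (ℂ × ℂ)} {I : ℂ × ℂ → ℂ}
    (h : IsIntegralBranch U I) {R₀ z₀ : ℂ} (h₀ : (R₀, z₀) ∈ U) (hQ : odeDen R₀ z₀ ≠ 0) :
    ∃ (N K : Set ℂ) (W : Set (ℂ × ℂ)) (ψ : ℂ → ℂ → ℂ),
      IsOpen N ∧ IsPreconnected N ∧ z₀ ∈ N ∧ IsOpen K ∧ I (R₀, z₀) ∈ K ∧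
      IsOpen W ∧ (R₀, z₀) ∈ W ∧ W ⊆ U ∧
      DifferentiableOn ℂ (fun q : ℂ × ℂ => ψ q.1 q.2) (N ×ˢ K) ∧
      (∀ z ∈ N, ∀ C ∈ K, (ψ z C, z) ∈ W ∧ I (ψ z C, z) = C ∧
        SolvesOdeAt (fun z' => ψ z' C) z) ∧
      (∀ R z : ℂ, (R, z) ∈ W → z ∈ N ∧ I (R, z) ∈ K ∧ ψ z (I (R, z)) = R) ∧
      (∀ (N' : Set ℂ) (ρ : ℂ → ℂ), N' ⊆ N → IsOpen N' → IsPreconnected N' → N'.Nonempty →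
        (∀ z ∈ N', (ρ z, z) ∈ W ∧ SolvesOdeAt ρ z) → ∃ C ∈ K, ∀ z ∈ N', ρ z = ψ z C) := by
  obtain ⟨H, hH⟩ := h.hasFDerivAt
  -- With the coordinates exchanged, I_R plays the part of the nonvanishing second partial
  -- derivative.
  have hV : IsOpen (Prod.swap ⁻¹' (U ∩ {p : ℂ × ℂ | abelRhs p.1 p.2 ≠ 0})) :=
    (h.1.inter (isOpen_ne_fun continuous_abelRhs continuous_const)).preimage continuous_swap
  obtain ⟨N, K, W, ψ, hN, hNc, hzN, hK, hIK, hW, hpW, hWV, hψ, hgr, hinv⟩ :=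
    exists_level_graphs (G := fun p => I p.swap)
      (α := fun p => H p.swap * abelLead p.swap.1 p.swap.2)
      (β := fun p => -(H p.swap * abelRhs p.swap.1 p.swap.2)) hV
      (fun p hp => ((hH p.swap hp.1).1.mul continuous_abelLead.continuousAt).comp
        continuous_swap.continuousAt)
      (fun p hp => ((hH p.swap hp.1).1.mul continuous_abelRhs.continuousAt).neg.comp
        continuous_swap.continuousAt)
      (fun p hp => neg_ne_zero.2 (mul_ne_zero (hH p.swap hp.1).2.1 hp.2))
      (fun p hp => by
        have hs : HasFDerivAt (Prod.swap : ℂ × ℂ → ℂ × ℂ)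
            ((ContinuousLinearMap.snd ℂ ℂ ℂ).prod (ContinuousLinearMap.fst ℂ ℂ ℂ)) p :=
          hasFDerivAt_snd.prodMk hasFDerivAt_fst
        exact ((hH p.swap hp.1).2.2.comp p hs).congr_fderiv (by ext <;> simp)) (x₀ := z₀) (y₀ :=
            R₀) ⟨h₀, by
          rw [← abelRhs_eq_odeDen] at hQ
          exact hQ⟩
  refine ⟨N, K, Prod.swap ⁻¹' W, ψ, hN, hNc, hzN, hK, hIK, hW.preimage continuous_swap, hpW,
    fun p hp => (hWV hp).1, hψ, ?_, fun R z hRz => hinv z R hRz, ?_⟩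
  · intro z hz C hC
    obtain ⟨h1, h2, h3⟩ := hgr z hz C hC
    have h4 : abelRhs (ψ z C) z ≠ 0 := (hWV h1).2
    have h5 := (hH _ (hWV h1).1).2.1
    have h6 := h4
    rw [abelRhs_eq_odeDen] at h6
    refine ⟨h1, h2, h6, h3.congr_deriv ?_⟩
    rw [odeRhs_eq, ← abelRhs_eq_odeDen]
    simp only [Prod.swap_prod_mk] at h5 ⊢
    field_simp
  · intro N' ρ hN' ho hc ⟨z, hz⟩ hsol
    obtain ⟨C, hC⟩ := h.const_of_solvesOdeAt ho hc
      fun z hz => ⟨(hWV (hsol z hz).1).1, (hsol z hz).2⟩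
    refine ⟨C, hC z hz ▸ (hinv z _ (hsol z hz).1).2.1, fun z' hz' => ?_⟩
    rw [← hC z' hz']
    exact (hinv z' _ (hsol z' hz').1).2.2.symm

end Kudashev

/-! ### Branches of roots and regularity at real points. -/

namespace Kudashev

open scoped Topology
open Filter

/-- A real point as a complex point. -/
def toComplex (q : ℝ × ℝ) : ℂ × ℂ := ((q.1 : ℂ), (q.2 : ℂ))

theorem continuous_toComplex : Continuous toComplex := by
  unfold toComplex
  fun_prop

theorem ofReal_cpow_inv_of_neg {x : ℝ} (hx : x < 0) (n : ℕ) :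
    (x : ℂ) ^ ((n : ℂ)⁻¹) = (-(x : ℂ)) ^ ((n : ℂ)⁻¹) * Complex.exp (Real.pi * Complex.I * (n :
        ℂ)⁻¹) :=
  Complex.ofReal_cpow_of_nonpos hx.le _

/-- Near a real point, the principal root of a holomorphic function that is real at real points
or takes a value off the cut coincides at real points with a holomorphic branch of the root. -/
theorem exists_root_branch {g : ℂ × ℂ → ℂ} {q₀ : ℝ × ℝ} {n : ℕ} (hn : n ≠ 0)
    (h0 : g (toComplex q₀) ≠ 0) (hg : ∀ᶠ p in 𝓝 (toComplex q₀), DifferentiableAt ℂ g p)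
    (hr : g (toComplex q₀) ∈ Complex.slitPlane ∨ ∀ᶠ q in 𝓝 q₀, (g (toComplex q)).im = 0) :
    ∃ κ : ℂ × ℂ → ℂ,
      (∀ᶠ p in 𝓝 (toComplex q₀), DifferentiableAt ℂ κ p ∧ κ p ^ n = g p) ∧
      ∀ᶠ q in 𝓝 q₀, κ (toComplex q) = g (toComplex q) ^ ((n : ℂ)⁻¹) := by
  have hgc : ContinuousAt g (toComplex q₀) := hg.self_of_nhds.continuousAt
  by_cases hsl : g (toComplex q₀) ∈ Complex.slitPlane
  · refine ⟨fun p => g p ^ ((n : ℂ)⁻¹), ?_, Eventually.of_forall fun _ => rfl⟩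
    filter_upwards [hg, hgc.eventually (Complex.isOpen_slitPlane.mem_nhds hsl)] with p h1 h2
    exact ⟨h1.cpow_const h2, Complex.cpow_nat_inv_pow _ hn⟩
  · have hre := hr.resolve_left hsl
    have him := hre.self_of_nhds
    have hlt : (g (toComplex q₀)).re < 0 := by
      rw [Complex.mem_slitPlane_iff, not_or, not_lt, not_not] at hsl
      refine lt_of_le_of_ne hsl.1 fun e => h0 (Complex.ext e him)
    have hneg : -g (toComplex q₀) ∈ Complex.slitPlane := Or.inl (by simpa using hlt)
    have hn' : (n : ℂ) ≠ 0 := by exact_mod_cast hn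
    -- At a negative real value the branch (-g)^(1/n) e^(iπ/n) is holomorphic, and it takes the
    -- principal value whenever g is a negative real.
    refine ⟨fun p => (-g p) ^ ((n : ℂ)⁻¹) * Complex.exp (Real.pi * Complex.I * (n : ℂ)⁻¹), ?_, ?_⟩
    · filter_upwards [hg, hgc.neg.eventually (Complex.isOpen_slitPlane.mem_nhds hneg)] with p h1 h2
      refine ⟨(h1.neg.cpow_const h2).mul_const _, ?_⟩
      rw [mul_pow, Complex.cpow_nat_inv_pow _ hn, ← Complex.exp_nat_mul, mul_comm (n : ℂ),
        mul_assoc, inv_mul_cancel₀ hn', mul_one, Complex.exp_pi_mul_I]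
      ring
    · have hq : ∀ᶠ q in 𝓝 q₀, (g (toComplex q)).re < 0 :=
        (Complex.continuous_re.continuousAt.comp (hgc.comp
            continuous_toComplex.continuousAt)).eventually_lt
          continuousAt_const hlt
      filter_upwards [hre, hq] with q h1 h2
      have e : g (toComplex q) = ((g (toComplex q)).re : ℂ) := Complex.ext rfl (by simpa using h1)
      rw [e, ofReal_cpow_inv_of_neg h2]

theorem a8_sq (R : ℂ) : a8 R ^ 2 = 3 * R ^ 4 - R ^ 2 := by
  have h := Complex.cpow_nat_inv_pow (3 * R ^ 4 - R ^ 2) two_ne_zero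
  rwa [Nat.cast_two, ← one_div, ← a8] at h

theorem eighteen_mul_sq_add_one_ne_zero (R : ℝ) : 18 * (R : ℂ) ^ 2 + 1 ≠ 0 := by
  have : (18 * R ^ 2 + 1 : ℝ) ≠ 0 := by positivity
  exact_mod_cast this

/-- The norm b₂(s) b₂(-s) equals 21 (18R² + 1)⁶, which has no real zero. The same device serves
`hFactor_ne_zero`. -/
theorem b2_ne_zero {s : ℂ} {R : ℝ} (hs : s ^ 2 = 3 * (R : ℂ) ^ 4 - (R : ℂ) ^ 2) : b2 s R ≠ 0 := by
  have h : b2 s R * b2 (-s) R = 21 * (18 * (R : ℂ) ^ 2 + 1) ^ 6 := by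
    unfold b2
    linear_combination (31968 * (R : ℂ) ^ 6 - 8532 * (R : ℂ) ^ 4 + 324 * (R : ℂ) ^ 2 - 1) ^ 2 *
        r21_sq
      - (-83160 * (R : ℂ) ^ 4 + 9576 * (R : ℂ) ^ 2 - 126) ^ 2 * hs
  refine left_ne_zero_of_mul (b := b2 (-s) R) ?_
  rw [h]
  exact mul_ne_zero (by norm_num) (pow_ne_zero 6 (eighteen_mul_sq_add_one_ne_zero R))

theorem hFactor_ne_zero {s : ℂ} {R : ℝ} (hs : s ^ 2 = 3 * (R : ℂ) ^ 4 - (R : ℂ) ^ 2) (hR : R ≠ 0)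
    (h0 : s ≠ 0) : hFactor s R ≠ 0 := by
  have h1 : (s - r21 * (R : ℂ) ^ 2) * (s + r21 * (R : ℂ) ^ 2)
      = -((R : ℂ) ^ 2 * (18 * (R : ℂ) ^ 2 + 1)) := by
    linear_combination hs - (R : ℂ) ^ 4 * r21_sq
  have hR' : (R : ℂ) ≠ 0 := by exact_mod_cast hR
  have h2 : s - r21 * (R : ℂ) ^ 2 ≠ 0 := by
    refine left_ne_zero_of_mul (b := s + r21 * (R : ℂ) ^ 2) ?_
    rw [h1]
    exact neg_ne_zero.2 (mul_ne_zero (pow_ne_zero 2 hR') (eighteen_mul_sq_add_one_ne_zero R))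
  refine left_ne_zero_of_mul (b := (R : ℂ) ^ 2) ?_
  rw [hFactor_mul hs]
  exact mul_ne_zero h0 h2

theorem c1_eq_div {s R : ℂ} (z : ℂ) (hs : s ^ 2 = 3 * R ^ 4 - R ^ 2) (h2 : b2 s R ≠ 0) :
    c1 s R z = 12 * i15 * a1 R * s / b1 s R z := by
  by_cases h1 : b1 s R z = 0
  · simp [c1, h1]
  · rw [eq_div_iff h1, c1_mul_b1 hs h1 h2]

theorem tendsto_b1_cobounded (s : ℂ) {R : ℝ} (hR : R ≠ 0) :
    Tendsto (fun z : ℝ => b1 s R z) (cocompact ℝ) (Bornology.cobounded ℂ) := by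
  have hR' : 9 * (R : ℂ) ≠ 0 := mul_ne_zero (by norm_num) (by exact_mod_cast hR)
  have h1 : Tendsto (fun z : ℝ => (z : ℂ)) (cocompact ℝ) (Bornology.cobounded ℂ) := by
    rw [← Metric.cobounded_eq_cocompact]
    exact RCLike.tendsto_ofReal_cobounded_cobounded ℂ
  have h2 := (tendsto_mul_left_cobounded hR').comp h1
  have h3 := (tendsto_add_const_cobounded
    (2 * i15 * s * (3 * (R : ℂ) ^ 2 - 1) + 126 * (R : ℂ) ^ 4 - 36 * (R : ℂ) ^ 2)).comp h2
  refine h3.congr fun z => ?_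
  simp only [Function.comp_apply, b1]
  ring

/-- b₁ is affine in z with slope 9R, so c₁ → 0 as |z| → ∞. At c = 0 the reduced denominator is i√15
R² ≠ 0, and the common factor vanishes for no large |z|. -/
theorem eventually_principalRegular {R : ℝ} (hR : R ≠ 0) (hR3 : 3 * R ^ 2 ≠ 1) :
    ∀ᶠ z : ℝ in cocompact ℝ, PrincipalRegular (R : ℂ) (z : ℂ) := by
  have hs := a8_sq (R : ℂ)
  have hR' : (R : ℂ) ≠ 0 := by exact_mod_cast hR
  have ha : a1 (R : ℂ) ≠ 0 := by
    intro h
    apply hR3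
    have : (3 : ℂ) * (R : ℂ) ^ 2 = 1 := by
      rw [a1] at h
      linear_combination 3 * h
    exact_mod_cast this
  have h0 : a8 (R : ℂ) ≠ 0 := by
    intro h
    rw [h] at hs
    apply ha
    apply mul_left_cancel₀ (pow_ne_zero 2 hR')
    rw [a1]
    linear_combination -hs / 3
  have hb2 := b2_ne_zero hs
  have hb1 := tendsto_b1_cobounded (a8 R) hR
  have hc : Tendsto (fun z : ℝ => c1 (a8 R) R z) (cocompact ℝ) (𝓝 0) := by
    have := (tendsto_inv₀_cobounded.comp hb1).const_mul (12 * i15 * a1 (R : ℂ) * a8 R)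
    rw [mul_zero] at this
    refine this.congr fun z => ?_
    rw [c1_eq_div _ hs hb2, div_eq_mul_inv]
    rfl
  have hF₃ := isHypergeometricOn_hypF exists_F₃
  have hF₄ := isHypergeometricOn_hypF exists_F₄
  set F₃ := hypF (-5 / 6) (1 / 6) (4 / 3)
  set F₄ := hypF (1 / 6) (7 / 6) (7 / 3)
  have hcut := isOpen_cutPlane.mem_nhds zero_mem_cutPlane
  have hred : ContinuousAt (fun c => redDen F₃ F₄ (a8 R) R c) 0 := by
    have g3 : ContinuousAt F₃ 0 := (hF₃.1.differentiableAt hcut).continuousAt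
    have g4 : ContinuousAt F₄ 0 := (hF₄.1.differentiableAt hcut).continuousAt
    unfold redDen
    fun_prop
  have hred0 : redDen F₃ F₄ (a8 R) R 0 ≠ 0 := by
    have z3 : F₃ 0 = 1 := by rw [hF₃.2.self_of_nhds, ordinaryHypergeometric_zero]
    simp [redDen, z3, i15_ne_zero, hR]
  filter_upwards [hb1.eventually (Bornology.eventually_ne_cobounded 0), hc.eventually hcut,
    hc.eventually (hred.eventually_ne hred0)] with z h1 h2 h3
  have hc0 : c1 (a8 R) R z ≠ 0 := by
    rw [c1_eq_div _ hs hb2]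
    exact div_ne_zero (mul_ne_zero (mul_ne_zero (mul_ne_zero (by norm_num) i15_ne_zero) ha) h0) h1
  refine ⟨h1, hb2, hc0, h2, ?_⟩
  rw [principalDen, integralDen_eq hs h0 h1 hb2]
  refine mul_ne_zero (mul_ne_zero two_ne_zero (div_ne_zero (mul_ne_zero (mul_ne_zero (mul_ne_zero
    (mul_ne_zero two_ne_zero i15_ne_zero) hb2) (hFactor_ne_zero hs hR h0)) h1) h0))
    (mul_ne_zero ?_ h3)
  simp [Complex.cpow_eq_zero_iff, hc0]

end Kudashev

/-! ### The principal formula as the trace of a holomorphic branch. -/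

namespace Kudashev

open scoped Topology
open Filter

theorem a8_sq_ofReal (R : ℝ) : a8 R ^ 2 = ((R ^ 2 * (3 * R ^ 2 - 1) : ℝ) : ℂ) := by
  rw [a8_sq]
  push_cast
  ring

theorem a8_im_eq_zero {R : ℝ} (hR : 1 < 3 * R ^ 2) : (a8 R).im = 0 := by
  have h := a8_sq_ofReal R
  have hre := congrArg Complex.re h
  have him := congrArg Complex.im h
  rw [pow_two, Complex.mul_re, Complex.ofReal_re] at hre
  rw [pow_two, Complex.mul_im, Complex.ofReal_im] at him
  have hpos : 0 < R ^ 2 * (3 * R ^ 2 - 1) := by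
    apply mul_pos <;> nlinarith
  have : (a8 R).re ≠ 0 := by
    intro e
    rw [e] at hre
    nlinarith [sq_nonneg (a8 R).im]
  have h2 : (a8 R).re * (a8 R).im = 0 := by linarith
  exact (mul_eq_zero.1 h2).resolve_left this

theorem a8_re_eq_zero {R : ℝ} (hR0 : R ≠ 0) (hR : 3 * R ^ 2 < 1) : (a8 R).re = 0 := by
  have h := a8_sq_ofReal R
  have hre := congrArg Complex.re h
  have him := congrArg Complex.im h
  rw [pow_two, Complex.mul_re, Complex.ofReal_re] at hre
  rw [pow_two, Complex.mul_im, Complex.ofReal_im] at him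
  have hneg : R ^ 2 * (3 * R ^ 2 - 1) < 0 :=
    mul_neg_of_pos_of_neg (by positivity) (by linarith)
  have : (a8 R).im ≠ 0 := by
    intro e
    rw [e] at hre
    nlinarith [sq_nonneg (a8 R).re]
  have h2 : (a8 R).re * (a8 R).im = 0 := by linarith
  exact (mul_eq_zero.1 h2).resolve_right this

/-- For 3R² > 1 the root a₈ is real, so c₁ = 2iα/(β + iα) with α, β real, and its real part 2α²/(α²
+ β²) is positive. -/
theorem c1_mem_slitPlane {R z : ℝ} (hR : 1 < 3 * R ^ 2) (h1 : b1 (a8 R) R z ≠ 0) :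
    c1 (a8 R) R z ∈ Complex.slitPlane := by
  have hs := a8_sq (R : ℂ)
  have hc := c1_mul_b1 hs h1 (b2_ne_zero hs)
  have hσ : a8 R = ((a8 R).re : ℂ) := Complex.ext rfl (by simpa using a8_im_eq_zero hR)
  have h0 : (a8 R).re ≠ 0 := by
    intro e
    rw [hσ, e] at hs
    have : (0 : ℝ) = R ^ 2 * (3 * R ^ 2 - 1) := by
      have : (0 : ℂ) = (R : ℂ) ^ 2 * (3 * (R : ℂ) ^ 2 - 1) := by
        rw [Complex.ofReal_zero] at hs
        linear_combination hs
      exact_mod_cast this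
    have hpos : 0 < R ^ 2 * (3 * R ^ 2 - 1) := by
      apply mul_pos <;> nlinarith
    linarith
  generalize (a8 R).re = σ at *
  rw [hσ] at hc ⊢
  set α : ℝ := 2 * Real.sqrt 15 * σ * (3 * R ^ 2 - 1) with hα
  set β : ℝ := 126 * R ^ 4 + 9 * z * R - 36 * R ^ 2 with hβ
  have hα0 : α ≠ 0 := by
    have : Real.sqrt 15 ≠ 0 := by positivity
    have h3 : 3 * R ^ 2 - 1 ≠ 0 := by linarith
    exact mul_ne_zero (mul_ne_zero (mul_ne_zero two_ne_zero this) h0) h3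
  have hb : b1 (σ : ℂ) R z = (β : ℂ) + (α : ℂ) * Complex.I := by
    rw [b1, i15, hα, hβ]
    push_cast
    ring
  have hn : 12 * i15 * a1 R * (σ : ℂ) = 2 * (α : ℂ) * Complex.I := by
    rw [a1, i15, hα]
    push_cast
    ring
  rw [hb, hn] at hc
  generalize c1 (σ : ℂ) R z = c at *
  have hre := congrArg Complex.re hc
  have him := congrArg Complex.im hc
  simp at hre him
  left
  have hx : c.re * (α ^ 2 + β ^ 2) = 2 * α ^ 2 := by linear_combination α * him + β * hre
  have hα2 : 0 < α ^ 2 := by positivity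
  by_contra hneg
  nlinarith [mul_nonneg (sub_nonneg.2 (not_lt.1 hneg)) (add_nonneg hα2.le (sq_nonneg β))]

/-- For 3R² < 1 the root a₈ is purely imaginary. It enters numerator and denominator only through
i√15 a₈, which is real. -/
theorem c1_im_eq_zero {R : ℝ} (hR0 : R ≠ 0) (hR : 3 * R ^ 2 < 1) (z : ℝ) :
    (c1 (a8 R) R z).im = 0 := by
  have hs := a8_sq (R : ℂ)
  rw [c1_eq_div _ hs (b2_ne_zero hs)]
  have hσ : a8 R = ((a8 R).im : ℂ) * Complex.I :=
    Complex.ext (by simpa using a8_re_eq_zero hR0 hR) (by simp)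
  generalize (a8 R).im = σ at *
  rw [hσ]
  have hw : i15 * ((σ : ℂ) * Complex.I) = ((-(Real.sqrt 15 * σ) : ℝ) : ℂ) := by
    rw [i15]
    push_cast
    linear_combination (Real.sqrt 15 : ℂ) * σ * Complex.I_sq
  have e : 12 * i15 * a1 R * ((σ : ℂ) * Complex.I) / b1 ((σ : ℂ) * Complex.I) R z
      = ((12 * -(Real.sqrt 15 * σ) * (R ^ 2 - 1 / 3) / (2 * -(Real.sqrt 15 * σ) * (3 * R ^ 2 - 1)
        + 126 * R ^ 4 + 9 * z * R - 36 * R ^ 2) : ℝ) : ℂ) := by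
    rw [b1, a1, mul_assoc 2 i15, hw, show 12 * i15 * ((R : ℂ) ^ 2 - 1 / 3) * ((σ : ℂ) * Complex.I)
      = 12 * (i15 * ((σ : ℂ) * Complex.I)) * ((R : ℂ) ^ 2 - 1 / 3) by ring, hw]
    push_cast
    ring
  rw [e, Complex.ofReal_im]

/-- Near a real point where the formula with principal branches makes sense, its values at real
points are those of a holomorphic branch of the integral. -/
theorem PrincipalRegular.exists_branch {q₀ : ℝ × ℝ} (h : PrincipalRegular (q₀.1 : ℂ) (q₀.2 : ℂ)) :
    ∃ (U : Set (ℂ × ℂ)) (I : ℂ × ℂ → ℂ), IsIntegralBranch U I ∧ toComplex q₀ ∈ U ∧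
      ∀ᶠ q in 𝓝 q₀, I (toComplex q) = principalIntegral (q.1 : ℂ) (q.2 : ℂ) := by
  obtain ⟨hb1, hb2, hc0, hcut, hden⟩ := h
  have hsq₀ := a8_sq (q₀.1 : ℂ)
  obtain ⟨h0, hR0'⟩ := ne_zero_of_c1_ne_zero hsq₀ hc0
  have hR0 : q₀.1 ≠ 0 := by exact_mod_cast hR0'
  have hR3 : 3 * q₀.1 ^ 2 ≠ 1 := by
    intro e
    apply pow_ne_zero 2 h0
    rw [a8_sq_ofReal, show q₀.1 ^ 2 * (3 * q₀.1 ^ 2 - 1) = 0 by rw [e]; ring]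
    simp
  obtain ⟨s, hs, hsr⟩ := exists_root_branch (g := fun p : ℂ × ℂ => 3 * p.1 ^ 4 - p.1 ^ 2) (q₀ := q₀)
    two_ne_zero (by
      rw [toComplex, ← hsq₀]
      exact pow_ne_zero 2 h0)
    (Eventually.of_forall fun p => by fun_prop)
    (Or.inr (Eventually.of_forall fun q => by
      have := congrArg Complex.im ((a8_sq _).symm.trans (a8_sq_ofReal q.1))
      rwa [Complex.ofReal_im] at this))
  have hsr' : ∀ᶠ q in 𝓝 q₀, s (toComplex q) = a8 (q.1 : ℂ) := by
    filter_upwards [hsr] with q hq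
    rw [hq, a8, Nat.cast_two, one_div]
    rfl
  have hs₀ : s (toComplex q₀) = a8 (q₀.1 : ℂ) := hsr'.self_of_nhds
  have hsd₀ := hs.self_of_nhds.1
  have hB1 : ContinuousAt (fun p : ℂ × ℂ => b1 (s p) p.1 p.2) (toComplex q₀) := by
    have := hsd₀.continuousAt
    unfold b1
    fun_prop
  have hB2 : ContinuousAt (fun p : ℂ × ℂ => b2 (s p) p.1) (toComplex q₀) := by
    have := hsd₀.continuousAt
    unfold b2
    fun_prop
  have ev1 : ∀ᶠ p in 𝓝 (toComplex q₀), b1 (s p) p.1 p.2 ≠ 0 :=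
    hB1.eventually_ne (by rw [hs₀]; exact hb1)
  have ev2 : ∀ᶠ p in 𝓝 (toComplex q₀), b2 (s p) p.1 ≠ 0 :=
    hB2.eventually_ne (by rw [hs₀]; exact hb2)
  set C : ℂ × ℂ → ℂ := fun p => c1 (s p) p.1 p.2 with hC
  have hC₀ : C (toComplex q₀) = c1 (a8 (q₀.1 : ℂ)) q₀.1 q₀.2 := by rw [hC, ← hs₀]; rfl
  have hCr : ∀ᶠ q in 𝓝 q₀, C (toComplex q) = c1 (a8 (q.1 : ℂ)) q.1 q.2 := by
    filter_upwards [hsr'] with q hq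
    rw [hC, ← hq]
    rfl
  have hCd : ∀ᶠ p in 𝓝 (toComplex q₀), DifferentiableAt ℂ C p := by
    filter_upwards [hs, ev1, ev2] with p h1 h2 h3
    have h4 := h1.1
    refine differentiableAt_div ?_ ?_ (mul_ne_zero h2 h3)
    · unfold b3 a1 a2 a9
      fun_prop
    · unfold b1 b2
      fun_prop
  obtain ⟨κ, hκ, hκr⟩ := exists_root_branch (g := C) (q₀ := q₀) three_ne_zero
    (by rw [hC₀]; exact hc0) hCd (by
      -- The two alternatives of `exists_root_branch`: c₁ is real at nearby real points when 3R² <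
      -- 1, and lies off the cut of the cube root when 3R² > 1.
      rcases lt_or_gt_of_ne hR3 with hlt | hgt
      · right
        have e1 : ∀ᶠ q : ℝ × ℝ in 𝓝 q₀, 3 * q.1 ^ 2 < 1 :=
          ContinuousAt.eventually_lt (by fun_prop) continuousAt_const hlt
        have e2 : ∀ᶠ q : ℝ × ℝ in 𝓝 q₀, q.1 ≠ 0 := continuousAt_fst.eventually_ne hR0
        filter_upwards [hCr, e1, e2] with q h1 h2 h3
        rw [h1, c1_im_eq_zero h3 h2]
      · left
        rw [hC₀]
        exact c1_mem_slitPlane hgt hb1)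
  have hκr' : ∀ᶠ q in 𝓝 q₀,
      κ (toComplex q) = c1 (a8 (q.1 : ℂ)) q.1 q.2 ^ (1 / 3 : ℂ) := by
    filter_upwards [hκr, hCr] with q hq h1
    rw [hq, h1, Nat.cast_ofNat, one_div]
  have hF₁ := isHypergeometricOn_hypF exists_F₁
  have hF₂ := isHypergeometricOn_hypF exists_F₂
  have hF₃ := isHypergeometricOn_hypF exists_F₃
  have hF₄ := isHypergeometricOn_hypF exists_F₄
  have hCc : ContinuousAt C (toComplex q₀) := hCd.self_of_nhds.continuousAt
  have hcut' : cutPlane ∈ 𝓝 (C (toComplex q₀)) := by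
    rw [hC₀]
    exact isOpen_cutPlane.mem_nhds hcut
  have hD : ContinuousAt (fun p : ℂ × ℂ => integralDen (hypF (-5 / 6) (1 / 6) (4 / 3))
      (hypF (1 / 6) (7 / 6) (7 / 3)) (s p) (κ p) p.1 p.2) (toComplex q₀) := by
    have g1 := hsd₀.continuousAt
    have g2 := hκ.self_of_nhds.1.continuousAt
    have g3 : ContinuousAt (fun p => hypF (-5 / 6) (1 / 6) (4 / 3) (C p)) (toComplex q₀) :=
      (hF₃.1.differentiableAt hcut').continuousAt.comp hCc
    have g4 : ContinuousAt (fun p => hypF (1 / 6) (7 / 6) (7 / 3) (C p)) (toComplex q₀) :=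
      (hF₄.1.differentiableAt hcut').continuousAt.comp hCc
    have g5 : ContinuousAt (fun p : ℂ × ℂ => b7 (s p) p.1 p.2) (toComplex q₀) := by
      unfold b7 a1 a2 a3 a4 a5 a9 a11
      fun_prop
    have g6 : ContinuousAt (fun p : ℂ × ℂ => a1 p.1) (toComplex q₀) := by
      unfold a1
      fun_prop
    have g7 : ContinuousAt (fun p : ℂ × ℂ => b5 p.1 + b9 (s p) p.1) (toComplex q₀) := by
      unfold b5 b9 a1 a4 a5
      fun_prop
    exact g2.mul ((g3.mul g5).add (((continuousAt_const.mul g4).mul g6).mul g7))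
  have hκ₀ := hκr'.self_of_nhds
  have evD := hD.eventually_ne (y := 0) (by
    rw [hs₀, hκ₀]
    exact hden)
  have good := hs.and (hκ.and (ev1.and (ev2.and ((hCc.eventually_ne (y := 0)
    (by rw [hC₀]; exact hc0)).and ((hCc.eventually hcut').and evD)))))
  obtain ⟨U, hU, hUo, hqU⟩ := eventually_nhds_iff.1 good
  refine ⟨U, fun p => integralNum (hypF (-7 / 6) (-1 / 6) (2 / 3)) (hypF (-1 / 6) (5 / 6) (5 / 3))
      (s p) p.1 p.2 / integralDen (hypF (-5 / 6) (1 / 6) (4 / 3)) (hypF (1 / 6) (7 / 6) (7 / 3))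
      (s p) (κ p) p.1 p.2, ⟨hUo, cutPlane, _, _, _, _, s, κ, isOpen_cutPlane,
      isPreconnected_cutPlane, zero_mem_cutPlane, one_notMem_cutPlane, hF₁, hF₂, hF₃, hF₄,
      fun p hp => (hU p hp).1.1.differentiableWithinAt,
      fun p hp => (hU p hp).2.1.1.differentiableWithinAt, fun p hp => ?_⟩, hqU, ?_⟩
  · obtain ⟨h1, h2, h3, h4, h5, h6, h7⟩ := hU p hp
    exact ⟨h1.2, h2.2, h3, h4, h5, h6, h7, rfl⟩
  · filter_upwards [hsr', hκr'] with q h1 h2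
    rw [h1, h2]
    rfl

end Kudashev

/-! ### Real solutions and the principal integral. -/

namespace Kudashev

open scoped Topology
open Filter

theorem ofReal_abelLead (R z : ℝ) : ((abelLead R z : ℝ) : ℂ) = abelLead (R : ℂ) (z : ℂ) := by
  unfold abelLead
  push_cast
  rfl

theorem ofReal_abelRhs (R z : ℝ) : ((abelRhs R z : ℝ) : ℂ) = abelRhs (R : ℂ) (z : ℂ) := by
  unfold abelRhs
  push_cast
  rfl

theorem ofReal_odeDen (R z : ℝ) : ((odeDen R z : ℝ) : ℂ) = odeDen (R : ℂ) (z : ℂ) := by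
  rw [← abelRhs_eq_odeDen, ← abelRhs_eq_odeDen, ofReal_abelRhs]

theorem ofReal_odeRhs (R z : ℝ) : ((odeRhs R z : ℝ) : ℂ) = odeRhs (R : ℂ) (z : ℂ) := by
  rw [odeRhs_eq, odeRhs_eq, Complex.ofReal_div, ofReal_abelLead, ofReal_odeDen]

/-- The integral with principal branches is stationary along a real curve whose velocity is
proportional to the direction field of the equation. -/
theorem PrincipalRegular.hasDerivAt_zero {ρ ζ : ℝ → ℝ} {τ v w : ℝ}
    (h : PrincipalRegular (ρ τ : ℂ) (ζ τ : ℂ)) (hρ : HasDerivAt ρ v τ) (hζ : HasDerivAt ζ w τ)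
    (hvw : abelLead (ρ τ) (ζ τ) * w = abelRhs (ρ τ) (ζ τ) * v) :
    HasDerivAt (fun t => principalIntegral (ρ t : ℂ) (ζ t : ℂ)) 0 τ := by
  obtain ⟨U, I, hI, hU, hev⟩ := h.exists_branch (q₀ := (ρ τ, ζ τ))
  obtain ⟨H, hH⟩ := hI.hasFDerivAt
  have hcont : Tendsto (fun t => (ρ t, ζ t)) (𝓝 τ) (𝓝 (ρ τ, ζ τ)) :=
    hρ.continuousAt.prodMk_nhds hζ.continuousAt
  have hcurve : HasDerivAt (fun t => toComplex (ρ t, ζ t)) ((v : ℂ), (w : ℂ)) τ :=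
    hρ.ofReal_comp.prodMk hζ.ofReal_comp
  have hd := ((hH _ hU).2.2.restrictScalars ℝ).comp_hasDerivAt τ hcurve
  refine HasDerivAt.congr_of_eventuallyEq (hd.congr_deriv ?_) ((hcont.eventually hev).mono
    fun t ht => ht.symm)
  have e : abelLead (ρ τ : ℂ) (ζ τ : ℂ) * w = abelRhs (ρ τ : ℂ) (ζ τ : ℂ) * v := by
    rw [← ofReal_abelLead, ← ofReal_abelRhs]
    exact_mod_cast hvw
  simp only [toComplex, ContinuousLinearMap.coe_restrictScalars', smul_apply, sub_apply,
    ContinuousLinearMap.coe_fst', ContinuousLinearMap.coe_snd', smul_eq_mul]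
  rw [e]
  ring

theorem hasDerivAt_of_ofReal {f : ℝ → ℝ} {f' : ℂ} {x : ℝ}
    (h : HasDerivAt (fun t => (f t : ℂ)) f' x) : HasDerivAt f f'.re x :=
  Complex.reCLM.hasFDerivAt.comp_hasDerivAt x h

theorem principal_const_of_solvesAbelAt {J : Set ℝ} {ζ : ℝ → ℝ} (hJ : IsOpen J)
    (hc : IsPreconnected J) (hreg : ∀ R ∈ J, PrincipalRegular (R : ℂ) (ζ R : ℂ))
    (hsol : ∀ R ∈ J, SolvesAbelAt ζ R) :
    ∃ C : ℂ, ∀ R ∈ J, principalIntegral (R : ℂ) (ζ R : ℂ) = C := by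
  have hd : ∀ R ∈ J, HasDerivAt (fun R : ℝ => principalIntegral (R : ℂ) (ζ R : ℂ)) 0 R := by
    intro R hR
    obtain ⟨ζ', h1, h2⟩ := hsol R hR
    exact PrincipalRegular.hasDerivAt_zero (ρ := id) (hreg R hR) (hasDerivAt_id R) h1
      (by rw [mul_one]; exact h2)
  exact hJ.exists_is_const_of_deriv_eq_zero hc
    (fun R hR => (hd R hR).differentiableAt.differentiableWithinAt) fun R hR => (hd R hR).deriv

theorem principal_const_of_solvesOdeAt {J : Set ℝ} {ρ : ℝ → ℝ} (hJ : IsOpen J)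
    (hc : IsPreconnected J) (hreg : ∀ z ∈ J, PrincipalRegular (ρ z : ℂ) (z : ℂ))
    (hsol : ∀ z ∈ J, SolvesOdeAt ρ z) :
    ∃ C : ℂ, ∀ z ∈ J, principalIntegral (ρ z : ℂ) (z : ℂ) = C := by
  have hd : ∀ z ∈ J, HasDerivAt (fun z : ℝ => principalIntegral (ρ z : ℂ) (z : ℂ)) 0 z := by
    intro z hz
    obtain ⟨h1, h2⟩ := hsol z hz
    refine PrincipalRegular.hasDerivAt_zero (ζ := id) (hreg z hz) h2 (hasDerivAt_id z) ?_
    rw [abelRhs_eq_odeDen, odeRhs_eq]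
    simp only [id]
    rw [mul_div_cancel₀ _ h1, mul_one]
  exact hJ.exists_is_const_of_deriv_eq_zero hc
    (fun R hR => (hd R hR).differentiableAt.differentiableWithinAt) fun R hR => (hd R hR).deriv

/-- Differentiability of ζ comes for free: continuity keeps its graph in W near each point, and
there constancy of I forces ζ = φ(·, C). -/
theorem solvesAbelAt_of_principal_const {J : Set ℝ} {ζ : ℝ → ℝ} (hJ : IsOpen J)
    (hreg : ∀ R ∈ J, PrincipalRegular (R : ℂ) (ζ R : ℂ)) (hζ : ContinuousOn ζ J)
    (hP : ∀ R ∈ J, abelLead R (ζ R) ≠ 0) {C : ℂ}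
    (hconst : ∀ R ∈ J, principalIntegral (R : ℂ) (ζ R : ℂ) = C) :
    ∀ R ∈ J, SolvesAbelAt ζ R := by
  intro R hR
  obtain ⟨U, I, hI, hU, hev⟩ := (hreg R hR).exists_branch (q₀ := (R, ζ R))
  have hP' : abelLead (R : ℂ) (ζ R : ℂ) ≠ 0 := by
    rw [← ofReal_abelLead]
    exact_mod_cast hP R hR
  obtain ⟨N, K, W, φ, -, -, hN, -, hK, hW, hpW, -, -, hgr, hinv, -⟩ :=
    hI.exists_abel_solutions hU hP'
  have hcont : Tendsto (fun t => (t, ζ t)) (𝓝 R) (𝓝 (R, ζ R)) :=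
    continuousAt_id.prodMk_nhds (hζ.continuousAt (hJ.mem_nhds hR))
  have hI₀ : I ((R : ℂ), (ζ R : ℂ)) = C := hev.self_of_nhds.trans (hconst R hR)
  rw [hI₀] at hK
  have hev' : ∀ᶠ t : ℝ in 𝓝 R, (ζ t : ℂ) = φ t C := by
    filter_upwards [hcont.eventually hev, hJ.mem_nhds hR,
      (continuous_toComplex.continuousAt.tendsto.comp hcont).eventually (hW.mem_nhds hpW)]
      with t h1 h2 h3
    have h4 := (hinv _ _ h3).2.2
    rw [show I ((t : ℂ), (ζ t : ℂ)) = C from h1.trans (hconst t h2)] at h4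
    exact h4.symm
  obtain ⟨-, -, -, φ', h1, h2⟩ := hgr R hN C hK
  -- φ(·, C) is a complex function that equals ζ at real points near R, so the derivative and the
  -- equation pass to real parts.
  have h3 := hasDerivAt_of_ofReal (h1.comp_ofReal.congr_of_eventuallyEq hev')
  refine ⟨φ'.re, h3, ?_⟩
  beta_reduce at h2
  rw [← hev'.self_of_nhds, ← ofReal_abelLead, ← ofReal_abelRhs] at h2
  simpa using congrArg Complex.re h2

theorem solvesOdeAt_of_principal_const {J : Set ℝ} {ρ : ℝ → ℝ} (hJ : IsOpen J)
    (hreg : ∀ z ∈ J, PrincipalRegular (ρ z : ℂ) (z : ℂ)) (hρ : ContinuousOn ρ J)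
    (hQ : ∀ z ∈ J, odeDen (ρ z) z ≠ 0) {C : ℂ}
    (hconst : ∀ z ∈ J, principalIntegral (ρ z : ℂ) (z : ℂ) = C) :
    ∀ z ∈ J, SolvesOdeAt ρ z := by
  intro z hz
  obtain ⟨U, I, hI, hU, hev⟩ := (hreg z hz).exists_branch (q₀ := (ρ z, z))
  have hQ' : odeDen (ρ z : ℂ) (z : ℂ) ≠ 0 := by
    rw [← ofReal_odeDen]
    exact_mod_cast hQ z hz
  obtain ⟨N, K, W, ψ, -, -, hN, -, hK, hW, hpW, -, -, hgr, hinv, -⟩ :=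
    hI.exists_ode_solutions hU hQ'
  have hcont : Tendsto (fun t => (ρ t, t)) (𝓝 z) (𝓝 (ρ z, z)) :=
    (hρ.continuousAt (hJ.mem_nhds hz)).prodMk_nhds continuousAt_id
  have hI₀ : I ((ρ z : ℂ), (z : ℂ)) = C := hev.self_of_nhds.trans (hconst z hz)
  rw [hI₀] at hK
  have hev' : ∀ᶠ t : ℝ in 𝓝 z, (ρ t : ℂ) = ψ t C := by
    filter_upwards [hcont.eventually hev, hJ.mem_nhds hz,
      (continuous_toComplex.continuousAt.tendsto.comp hcont).eventually (hW.mem_nhds hpW)]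
      with t h1 h2 h3
    have h4 := (hinv _ _ h3).2.2
    rw [show I ((ρ t : ℂ), (t : ℂ)) = C from h1.trans (hconst t h2)] at h4
    exact h4.symm
  obtain ⟨-, -, -, h1⟩ := hgr z hN C hK
  have h3 := hasDerivAt_of_ofReal (h1.comp_ofReal.congr_of_eventuallyEq hev')
  refine ⟨hQ z hz, ?_⟩
  beta_reduce at h3
  rwa [← hev'.self_of_nhds, ← ofReal_odeRhs, Complex.ofReal_re] at h3

end Kudashev

theorem mainTheorem1 :
    -- the principal branches of the four hypergeometric functions
    (Kudashev.IsHypergeometricOn Kudashev.cutPlane (-7 / 6) (-1 / 6) (2 / 3)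
        (Kudashev.hypF (-7 / 6) (-1 / 6) (2 / 3)) ∧
      Kudashev.IsHypergeometricOn Kudashev.cutPlane (-1 / 6) (5 / 6) (5 / 3)
        (Kudashev.hypF (-1 / 6) (5 / 6) (5 / 3)) ∧
      Kudashev.IsHypergeometricOn Kudashev.cutPlane (-5 / 6) (1 / 6) (4 / 3)
        (Kudashev.hypF (-5 / 6) (1 / 6) (4 / 3)) ∧
      Kudashev.IsHypergeometricOn Kudashev.cutPlane (1 / 6) (7 / 6) (7 / 3)
        (Kudashev.hypF (1 / 6) (7 / 6) (7 / 3))) ∧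
    -- every holomorphic branch is a nondegenerate first integral, and its level sets are
    -- locally the solutions
    (∀ (U : Set (ℂ × ℂ)) (I : ℂ × ℂ → ℂ), Kudashev.IsIntegralBranch U I →
      DifferentiableOn ℂ I U ∧
      (∀ R z : ℂ, (R, z) ∈ U →
        Kudashev.abelLead R z * fderiv ℂ I (R, z) (1, 0)
            + Kudashev.abelRhs R z * fderiv ℂ I (R, z) (0, 1) = 0 ∧
        (Kudashev.abelLead R z ≠ 0 → fderiv ℂ I (R, z) (0, 1) ≠ 0) ∧
        (Kudashev.abelRhs R z ≠ 0 → fderiv ℂ I (R, z) (1, 0) ≠ 0)) ∧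
      (∀ (N : Set ℂ) (ζ : ℂ → ℂ), IsOpen N → IsPreconnected N →
        (∀ R ∈ N, (R, ζ R) ∈ U ∧ Kudashev.SolvesAbelAt ζ R) →
        ∃ C : ℂ, ∀ R ∈ N, I (R, ζ R) = C) ∧
      (∀ (N : Set ℂ) (ρ : ℂ → ℂ), IsOpen N → IsPreconnected N →
        (∀ z ∈ N, (ρ z, z) ∈ U ∧ Kudashev.SolvesOdeAt ρ z) →
        ∃ C : ℂ, ∀ z ∈ N, I (ρ z, z) = C) ∧
      (∀ R₀ z₀ : ℂ, (R₀, z₀) ∈ U → Kudashev.abelLead R₀ z₀ ≠ 0 →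
        ∃ (N K : Set ℂ) (W : Set (ℂ × ℂ)) (φ : ℂ → ℂ → ℂ),
          IsOpen N ∧ IsPreconnected N ∧ R₀ ∈ N ∧ IsOpen K ∧ I (R₀, z₀) ∈ K ∧
          IsOpen W ∧ (R₀, z₀) ∈ W ∧ W ⊆ U ∧
          DifferentiableOn ℂ (fun q : ℂ × ℂ => φ q.1 q.2) (N ×ˢ K) ∧
          (∀ R ∈ N, ∀ C ∈ K, (R, φ R C) ∈ W ∧ I (R, φ R C) = C ∧
            Kudashev.abelLead R (φ R C) ≠ 0 ∧
            Kudashev.SolvesAbelAt (fun R' => φ R' C) R) ∧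
          (∀ R z : ℂ, (R, z) ∈ W → R ∈ N ∧ I (R, z) ∈ K ∧ φ R (I (R, z)) = z) ∧
          (∀ (N' : Set ℂ) (ζ : ℂ → ℂ), N' ⊆ N → IsOpen N' → IsPreconnected N' → N'.Nonempty →
            (∀ R ∈ N', (R, ζ R) ∈ W ∧ Kudashev.SolvesAbelAt ζ R) →
            ∃ C ∈ K, ∀ R ∈ N', ζ R = φ R C)) ∧
      (∀ R₀ z₀ : ℂ, (R₀, z₀) ∈ U → Kudashev.odeDen R₀ z₀ ≠ 0 →
        ∃ (N K : Set ℂ) (W : Set (ℂ × ℂ)) (ψ : ℂ → ℂ → ℂ),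
          IsOpen N ∧ IsPreconnected N ∧ z₀ ∈ N ∧ IsOpen K ∧ I (R₀, z₀) ∈ K ∧
          IsOpen W ∧ (R₀, z₀) ∈ W ∧ W ⊆ U ∧
          DifferentiableOn ℂ (fun q : ℂ × ℂ => ψ q.1 q.2) (N ×ˢ K) ∧
          (∀ z ∈ N, ∀ C ∈ K, (ψ z C, z) ∈ W ∧ I (ψ z C, z) = C ∧
            Kudashev.SolvesOdeAt (fun z' => ψ z' C) z) ∧
          (∀ R z : ℂ, (R, z) ∈ W → z ∈ N ∧ I (R, z) ∈ K ∧ ψ z (I (R, z)) = R) ∧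
          (∀ (N' : Set ℂ) (ρ : ℂ → ℂ), N' ⊆ N → IsOpen N' → IsPreconnected N' → N'.Nonempty →
            (∀ z ∈ N', (ρ z, z) ∈ W ∧ Kudashev.SolvesOdeAt ρ z) →
            ∃ C ∈ K, ∀ z ∈ N', ρ z = ψ z C))) ∧
    -- the formula with principal branches at real points
    (∀ R : ℝ, R ≠ 0 → 3 * R ^ 2 ≠ 1 →
      ∀ᶠ z : ℝ in Filter.cocompact ℝ, Kudashev.PrincipalRegular (R : ℂ) (z : ℂ)) ∧
    (∀ (J : Set ℝ) (ζ : ℝ → ℝ), IsOpen J → IsPreconnected J →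
      (∀ R ∈ J, Kudashev.PrincipalRegular (R : ℂ) (ζ R : ℂ)) →
      ((∀ R ∈ J, Kudashev.SolvesAbelAt ζ R) →
        ∃ C : ℂ, ∀ R ∈ J, Kudashev.principalIntegral (R : ℂ) (ζ R : ℂ) = C) ∧
      (ContinuousOn ζ J → (∀ R ∈ J, Kudashev.abelLead R (ζ R) ≠ 0) →
        (∃ C : ℂ, ∀ R ∈ J, Kudashev.principalIntegral (R : ℂ) (ζ R : ℂ) = C) →
        ∀ R ∈ J, Kudashev.SolvesAbelAt ζ R)) ∧
    (∀ (J : Set ℝ) (ρ : ℝ → ℝ), IsOpen J → IsPreconnected J →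
      (∀ z ∈ J, Kudashev.PrincipalRegular (ρ z : ℂ) (z : ℂ)) →
      ((∀ z ∈ J, Kudashev.SolvesOdeAt ρ z) →
        ∃ C : ℂ, ∀ z ∈ J, Kudashev.principalIntegral (ρ z : ℂ) (z : ℂ) = C) ∧
      (ContinuousOn ρ J → (∀ z ∈ J, Kudashev.odeDen (ρ z) z ≠ 0) →
        (∃ C : ℂ, ∀ z ∈ J, Kudashev.principalIntegral (ρ z : ℂ) (z : ℂ) = C) →
        ∀ z ∈ J, Kudashev.SolvesOdeAt ρ z)) := by
  refine ⟨⟨Kudashev.isHypergeometricOn_hypF Kudashev.exists_F₁,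
    Kudashev.isHypergeometricOn_hypF Kudashev.exists_F₂,
    Kudashev.isHypergeometricOn_hypF Kudashev.exists_F₃,
    Kudashev.isHypergeometricOn_hypF Kudashev.exists_F₄⟩, fun U I hI => ?_,
    fun R hR hR3 => Kudashev.eventually_principalRegular hR hR3, fun J ζ hJ hc hreg => ?_,
    fun J ρ hJ hc hreg => ?_⟩
  · obtain ⟨H, hH⟩ := hI.hasFDerivAt
    refine ⟨fun p hp => (hH p hp).2.2.differentiableAt.differentiableWithinAt, fun R z hp => ?_,
      fun N ζ => hI.const_of_solvesAbelAt, fun N ρ => hI.const_of_solvesOdeAt,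
      fun R₀ z₀ => hI.exists_abel_solutions, fun R₀ z₀ => hI.exists_ode_solutions⟩
    obtain ⟨-, h0, hd⟩ := hH _ hp
    rw [hd.fderiv]
    simp only [smul_apply, sub_apply, ContinuousLinearMap.coe_fst', ContinuousLinearMap.coe_snd',
      smul_eq_mul, mul_zero, mul_one, zero_sub, sub_zero]
    exact ⟨by ring, fun hP => mul_ne_zero h0 hP, fun hQ => mul_ne_zero h0 (neg_ne_zero.2 hQ)⟩
  · exact ⟨Kudashev.principal_const_of_solvesAbelAt hJ hc hreg, fun hζ hP ⟨_, hC⟩ =>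
      Kudashev.solvesAbelAt_of_principal_const hJ hreg hζ hP hC⟩
  · exact ⟨Kudashev.principal_const_of_solvesOdeAt hJ hc hreg, fun hρ hQ ⟨_, hC⟩ =>
      Kudashev.solvesOdeAt_of_principal_const hJ hreg hρ hQ hC⟩
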